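/- **Setting.** Let $G=(V,E)$ be a finite simple connected undirected graph with maximum degree $\Delta$ and diameter $D$, and let $\mathcal S,\mathcal T\subseteq V$ be non-empty and disjoint (senders and targets). $N(v)$ is the set of neighbours of $v$; each node $v$ has a bijective labelling $N(v)\to\{1,\dots,|N(v)|\}$. A directed subgraph of $G$ (nodes in $V$, arcs $(u,v)$ only for $\{u,v\}\in E$) is a *weakly $\mathcal{ST}$-reachable DAG* if (C1) every sender can reach some target, (C2) every target is reachable from some sender, and (C3) it has no directed cycle; it is *minimal* if removing any one arc violates C1 or C2. **Model.** In a step from a configuration (a vector of node states), every enabled node of a scheduled non-empty set of nodes simultaneously performs one atomic action, which reads its own state and those of its neighbours and rewrites its own state; disabled nodes do nothing. An execution is fair if every node is scheduled infinitely often. A configuration is *final* if no step changes it; an algorithm is *silent* if every fair execution reaches a final configuration. It is *self-stabilizing* for a specification if there is a set $\mathcal F$ of (legitimate) configurations that every fair execution from any configuration reaches, that is closed under steps, and all of whose members satisfy the specification. A *round* is the shortest segment of an execution in which every node enabled at its beginning is scheduled or becomes disabled; rounds are consecutive. **Algorithm MWSTDAG.** A node $v$ has variables $d_1,d_2\in\mathbb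 N$, $p_1,p_2\in N(v)\cup\{v\}$, Booleans $\mathit{red},\mathit{blue},\mathit{br}$, and Booleans $a_3[u],a[u]$ for $u\in N(v)$. It performs only the first action in the following list whose guard holds. Write $R=\{u\in N(v): u.p_1=v,\ u.\mathit{red}\}$, $L=\{u\in N(v): u.p_2=v,\ u.\mathit{blue}\}$, $B=\{u\in N(v): u.p_1=v,\ u.\mathit{br}\}$. 1. Layer 1: one variable at a time, in this order, if it differs from its correct value: $d_1\gets 0$ if $v\in\mathcal S$ and $1+\min_{u\in N(v)}u.d_1$ otherwise; $p_1\gets v$ if $v\in\mathcal S$ and the minimum-label neighbour minimizing $u.d_1$ otherwise; $\mathit{red}\gets (v\in\mathcal T\vee R\ne\emptyset)$. 2. Layer 2: likewise, $d_2\gets 0$ if $v.\mathit{red}$ and $1+\min_{u\in N(v)} u.d_2$ otherwise; $p_2\gets v$ if $v.\mathit{red}$ and the minimum-label neighbour minimizing $u.d_2$ otherwise; $\mathit{blue}\gets(\neg v.\mathit{red}\wedge(v\in\mathcal S\vee L\neq\emptyset))$. 3. Layer 3: if some $a_3[u]$ is wrong, set every wrong $a_3[u]$ to $(v.\mathit{red}\wedge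 u\in R)\vee(v.\mathit{blue}\wedge v.p_2=u)$. 4. Layer 4, in this order: (i) set $a[u]\gets$ false for all $u$ with $a[u]\wedge\neg a_3[u]$; (ii) $\mathit{br}\gets v.\mathit{red}\wedge\bigl(L\ne\emptyset\vee(B=R\neq\emptyset\wedge v\notin\mathcal T)\bigr)$; (iii) set $a[u]\gets$ true for all non-redundant $u$ with $a_3[u]\wedge\neg a[u]$; (iv) set $a[u]\gets$ false for all redundant $u$ with $a[u]$. Here $u\in N(v)$ is redundant if $u\in B\subsetneq R$; or $u\in B=R$ and $u$ is not the minimum-label member of $B$; or $u\in B=R$ and $v\in\mathcal T$; or $v.p_1\ne v$, $v.p_1$ has $a[v]=$ false, and $L=\emptyset$. The output digraph of a configuration has node set $V$ and the arcs $(v,u)$ with $\{u,v\}\in E$ and $v.a[u]$ true; the specification is that it is a minimal weakly $\mathcal{ST}$-reachable DAG of $G$. **Theorem.** There is a universal constant $c$ such that for all $G,\mathcal S,\mathcal T$ and labellings as above: 1. MWSTDAG is self-stabilizing for the construction of a minimal weakly $\mathcal{ST}$-reachable DAG, and it is silent. 2. From any configuration, every fair execution reaches a final configuration within $c\,D$ rounds;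 the output digraph of every final configuration is a minimal weakly $\mathcal{ST}$-reachable DAG, and all of its variables $d_1,d_2$ are at most $D$. 3. Each node uses $O(\log D+\Delta)$ bits of memory: in executions started with all distance variables $d_1,d_2$ at most $D$, the states of each node always stay in a set of states that is encoded injectively in $c(\log_2 D+\Delta)$ bits. More generally, if the initial distance variables are at most $M$, $c(\log_2\max(M,D)+\Delta)$ bits suffice. 4. In particular, a minimal weakly $\mathcal{ST}$-reachable DAG of $G$ always exists. -/

import Mathlib

namespace MWST

/-- The neighbours of `v`. -/
abbrev Nbr {V : Type*} (G : SimpleGraph V) (v : V) : Type _ := {u : V // G.Adj v u}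

/-- The neighbours of `v` together with `v` itself. -/
abbrev CNbr {V : Type*} (G : SimpleGraph V) (v : V) : Type _ := {u : V // u = v ∨ G.Adj v u}

/-! ### The state reading model -/

/-- A configuration: one state for each node. -/
abbrev Config {V : Type*} (Q : V → Type*) : Type _ := ∀ v, Q v

/-- What node `v` can read: its own state and the states of its neighbours. -/
abbrev View {V : Type*} (G : SimpleGraph V) (Q : V → Type*) (v : V) : Type _ :=
  ∀ u : CNbr G v, Q u.1

/-- The part of a configuration that `v` can read. -/
def view {V : Type*} (G : SimpleGraph V) {Q : V → Type*} (C : Config Q) (v : V) : View G Q v :=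
  fun u => C u.1

/-- An atomic action `guard → statement`, instantiated at every node. Both parts depend only on
what the node can read, and the statement produces the new state of the node itself. -/
structure GuardedAction {V : Type*} (G : SimpleGraph V) (Q : V → Type*) where
  guard : ∀ v, View G Q v → Prop
  statement : ∀ v, View G Q v → Q v

/-- A distributed algorithm: a finite set of actions, written as a list. -/
abbrev Algorithm {V : Type*} (G : SimpleGraph V) (Q : V → Type*) : Type _ :=
  List (GuardedAction G Q)

section Model

variable {V : Type*} {G : SimpleGraph V} {Q : V → Type*}

/-- The hierarchical collateral composition `B ∘ A`: all actions of `A`, and the actions of `B`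
whose guards are strengthened by the negation of the disjunction of all guards of `A`. -/
def compose (B A : Algorithm G Q) : Algorithm G Q :=
  A ++ B.map fun b =>
    { guard := fun v σ => (¬ ∃ a ∈ A, a.guard v σ) ∧ b.guard v σ
      statement := b.statement }

/-- Priorities inside one layer: an action is enabled only if the guards of all the actions
listed before it are false. -/
def prioritize : Algorithm G Q → Algorithm G Q
  | [] => []
  | a :: l => compose (prioritize l) [a]

/-- Node `v` is enabled in `C`: at least one action of `v` is enabled. -/
def Enabled (A : Algorithm G Q) (C : Config Q) (v : V) : Prop :=
  ∃ a ∈ A, a.guard v (view G C v)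

/-- `C ↦ C'` when every node of `X` performs an (enabled) atomic action simultaneously. Nodes
outside `X`, and nodes of `X` that are disabled, keep their states. -/
def Step (A : Algorithm G Q) (X : Set V) (C C' : Config Q) : Prop :=
  ∀ v, (v ∈ X → Enabled A C v →
      ∃ a ∈ A, a.guard v (view G C v) ∧ C' v = a.statement v (view G C v)) ∧
    (¬ (v ∈ X ∧ Enabled A C v) → C' v = C v)

/-- `Ξ` is an execution of `A` along the schedule `S` (a sequence of non-empty sets of nodes). -/
def IsExecution (A : Algorithm G Q) (S : ℕ → Set V) (Ξ : ℕ → Config Q) : Prop :=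
  (∀ i, (S i).Nonempty) ∧ ∀ i, Step A (S i) (Ξ i) (Ξ (i + 1))

/-- Weak fairness: each node appears infinitely often in the schedule. -/
def IsFair (S : ℕ → Set V) : Prop :=
  ∀ v n, ∃ i, n ≤ i ∧ v ∈ S i

/-- A final configuration: no non-empty set of nodes can change it. -/
def IsFinal (A : Algorithm G Q) (C : Config Q) : Prop :=
  ∀ X : Set V, X.Nonempty → Step A X C C

/-- A silent algorithm: every fair execution reaches a final configuration. -/
def IsSilent (A : Algorithm G Q) : Prop :=
  ∀ S Ξ, IsFair S → IsExecution A S Ξ → ∃ i, IsFinal A (Ξ i)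

/-- `F` is a set of legitimate configurations of `A` for the problem with specification `P`. -/
structure IsLegitimateSet (A : Algorithm G Q) (P : Config Q → Prop) (F : Set (Config Q)) :
    Prop where
  convergence : ∀ S Ξ, IsFair S → IsExecution A S Ξ → ∃ i, Ξ i ∈ F
  closure : ∀ X C C', C ∈ F → Step A X C C' → C' ∈ F
  correctness : ∀ C ∈ F, P C

/-- `A` is self-stabilizing for the problem with specification `P`. -/
def IsSelfStabilizing (A : Algorithm G Q) (P : Config Q → Prop) : Prop :=
  ∃ F : Set (Config Q), IsLegitimateSet A P F

/-- Between times `t` and `t'`, every node that is enabled at time `t` is scheduled or becomes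
disabled. -/
def CoversRound (A : Algorithm G Q) (S : ℕ → Set V) (Ξ : ℕ → Config Q) (t t' : ℕ) : Prop :=
  ∀ v, Enabled A (Ξ t) v → ∃ i, t ≤ i ∧ i < t' ∧
    (v ∈ S i ∨ (Enabled A (Ξ i) v ∧ ¬ Enabled A (Ξ (i + 1)) v))

/-- `RoundEnd A S Ξ k t`: the first `k` asynchronous rounds of the execution are exactly the steps
before time `t`, so `Ξ t` is the configuration at the end of round `k`. Each round is the shortest
segment that covers all the nodes enabled at its beginning. -/
inductive RoundEnd (A : Algorithm G Q) (S : ℕ → Set V) (Ξ : ℕ → Config Q) : ℕ → ℕ → Prop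
  | zero : RoundEnd A S Ξ 0 0
  | succ {k t t' : ℕ} : RoundEnd A S Ξ k t →
      IsLeast {r | t ≤ r ∧ CoversRound A S Ξ t r} t' → RoundEnd A S Ξ (k + 1) t'

/-- Every fair execution, from any configuration, reaches a final configuration within `r`
rounds. -/
def FinalWithinRounds (A : Algorithm G Q) (r : ℕ) : Prop :=
  ∀ S Ξ, IsFair S → IsExecution A S Ξ →
    ∃ k t, k ≤ r ∧ RoundEnd A S Ξ k t ∧ IsFinal A (Ξ t)

/-- Started with node states in `I`, the algorithm runs in `b` bits of memory per node: every node
has a set of states that contains its initial ones, is encoded injectively by bit strings of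
length `b`, and is never left, whatever nodes are scheduled. -/
def RunsInBits (A : Algorithm G Q) (I : ∀ v, Set (Q v)) (b : ℕ) : Prop :=
  ∃ R : ∀ v, Set (Q v),
    (∀ v, I v ⊆ R v) ∧
    (∀ X C C', (∀ v, C v ∈ R v) → Step A X C C' → ∀ v, C' v ∈ R v) ∧
    ∀ v, ∃ enc : Q v → (Fin b → Bool), Set.InjOn enc (R v)

end Model

/-! ### Networks and the problem -/

/-- A simple connected graph with non-empty disjoint sets of senders and targets; every node
distinguishes its neighbours by the local labels `1, …, δ`, where `δ` is its degree. -/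
structure Network (V : Type*) where
  graph : SimpleGraph V
  senders : Set V
  targets : Set V
  label : ∀ v, Nbr graph v → ℕ
  connected : graph.Connected
  senders_nonempty : senders.Nonempty
  targets_nonempty : targets.Nonempty
  disjoint : Disjoint senders targets
  label_bijOn : ∀ v, Set.BijOn (label v) Set.univ (Set.Icc 1 (graph.neighborSet v).ncard)

open Classical in
/-- The maximum degree. -/
noncomputable def Network.maxDeg {V : Type*} [Fintype V] (N : Network V) : ℕ :=
  N.graph.maxDegree

/-- The diameter. -/
noncomputable def Network.diam {V : Type*} (N : Network V) : ℕ :=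
  N.graph.diam

/-- A directed subgraph of an undirected graph. -/
structure DirSubgraph {V : Type*} (G : SimpleGraph V) where
  verts : Set V
  arc : V → V → Prop
  left_mem : ∀ u v, arc u v → u ∈ verts
  right_mem : ∀ u v, arc u v → v ∈ verts
  adj : ∀ u v, arc u v → G.Adj u v

namespace DirSubgraph

variable {V : Type*} {G : SimpleGraph V}

/-- There is a directed path from `u` to `v`. -/
def Reach (H : DirSubgraph G) (u v : V) : Prop :=
  u ∈ H.verts ∧ Relation.ReflTransGen H.arc u v

/-- Remove the arc `(a, b)`. -/
def removeArc (H : DirSubgraph G) (a b : V) : DirSubgraph G where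
  verts := H.verts
  arc u v := H.arc u v ∧ ¬ (u = a ∧ v = b)
  left_mem u v h := H.left_mem u v h.1
  right_mem u v h := H.right_mem u v h.1
  adj u v h := H.adj u v h.1

end DirSubgraph

section Problem

variable {V : Type*} (N : Network V)

/-- Every sender can reach at least one target. -/
def SendersReach (H : DirSubgraph N.graph) : Prop :=
  ∀ s ∈ N.senders, ∃ t ∈ N.targets, H.Reach s t

/-- Every target is reachable from a sender. -/
def TargetsReached (H : DirSubgraph N.graph) : Prop :=
  ∀ t ∈ N.targets, ∃ s ∈ N.senders, H.Reach s t

/-- A weakly ST-reachable DAG. -/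
structure IsWeaklySTReachableDAG (H : DirSubgraph N.graph) : Prop where
  senders_reach : SendersReach N H
  targets_reached : TargetsReached N H
  acyclic : ∀ v, ¬ Relation.TransGen H.arc v v

/-- A minimal weakly ST-reachable DAG: the removal of any arc violates one of the two
reachability conditions. -/
structure IsMinimalWeaklySTReachableDAG (H : DirSubgraph N.graph) : Prop
    extends IsWeaklySTReachableDAG N H where
  minimal : ∀ a b, H.arc a b →
    ¬ (SendersReach N (H.removeArc a b) ∧ TargetsReached N (H.removeArc a b))

/-! ### The algorithm -/

/-- The variables of node `v`. -/
structure NodeState (v : V) where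
  l1Dist : ℕ
  l1Parent : CNbr N.graph v
  l1Color : Bool
  l2Dist : ℕ
  l2Parent : CNbr N.graph v
  l2Color : Bool
  l3Arc : Nbr N.graph v → Bool
  arc : Nbr N.graph v → Bool
  l4Branch : Bool

/-- The output digraph of a configuration: all nodes, and the arcs given by the variables `arc`. -/
def outputDigraph (C : Config (NodeState N)) : DirSubgraph N.graph where
  verts := Set.univ
  arc v u := ∃ h : N.graph.Adj v u, (C v).arc ⟨u, h⟩ = true
  left_mem _ _ _ := Set.mem_univ _
  right_mem _ _ _ := Set.mem_univ _
  adj _ _ h := h.1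

/-- The specification of the minimal weakly ST-reachable DAG construction. -/
def Spec (C : Config (NodeState N)) : Prop :=
  IsMinimalWeaklySTReachableDAG N (outputDigraph N C)

/-- The node `v` as a member of its closed neighbourhood. -/
def self (v : V) : CNbr N.graph v := ⟨v, Or.inl rfl⟩

open Classical in
/-- The member of `P` with the minimum label at `v` (and `v` itself if `P` is empty). -/
noncomputable def minLabel (v : V) (P : Set (Nbr N.graph v)) : CNbr N.graph v :=
  if h : P.Nonempty then
    ⟨(Function.argminOn (N.label v) P h).1, Or.inr (Function.argminOn (N.label v) P h).2⟩
  else self N v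

end Problem

section Macros

variable {V : Type*} {N : Network V} {v : V} (σ : View N.graph (NodeState N) v)

/-- The state of the node itself. -/
def own : NodeState N v := σ (self N v)

/-- The state of a neighbour. -/
def nbr (u : Nbr N.graph v) : NodeState N u.1 := σ ⟨u.1, Or.inr u.2⟩

/-! Layer 1 -/

noncomputable def nearestL1ParentDist : ℕ := ⨅ u : Nbr N.graph v, (nbr σ u).l1Dist

open Classical in
noncomputable def l1CorrectDist : ℕ :=
  if v ∈ N.senders then 0 else nearestL1ParentDist σ + 1

noncomputable def nearestL1Parent : CNbr N.graph v :=
  minLabel N v {u | ∀ w, (nbr σ u).l1Dist ≤ (nbr σ w).l1Dist}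

open Classical in
noncomputable def l1CorrectParent : CNbr N.graph v :=
  if v ∈ N.senders then self N v else nearestL1Parent σ

def redChild : Set (Nbr N.graph v) :=
  {u | (nbr σ u).l1Parent.1 = v ∧ (nbr σ u).l1Color = true}

def isRed : Prop := v ∈ N.targets ∨ (redChild σ).Nonempty

/-! Layer 2 -/

noncomputable def nearestL2ParentDist : ℕ := ⨅ u : Nbr N.graph v, (nbr σ u).l2Dist

noncomputable def l2CorrectDist : ℕ :=
  if (own σ).l1Color = true then 0 else nearestL2ParentDist σ + 1

noncomputable def nearestL2Parent : CNbr N.graph v :=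
  minLabel N v {u | ∀ w, (nbr σ u).l2Dist ≤ (nbr σ w).l2Dist}

noncomputable def l2CorrectParent : CNbr N.graph v :=
  if (own σ).l1Color = true then self N v else nearestL2Parent σ

def blueChild : Set (Nbr N.graph v) :=
  {u | (nbr σ u).l2Parent.1 = v ∧ (nbr σ u).l2Color = true}

def isBlue : Prop :=
  (own σ).l1Color = false ∧ (v ∈ N.senders ∨ (blueChild σ).Nonempty)

/-! Layer 3 -/

def hasL3Arc (u : Nbr N.graph v) : Prop :=
  ((own σ).l1Color = true ∧ u ∈ redChild σ) ∨
    ((own σ).l2Color = true ∧ (own σ).l2Parent.1 = u.1)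

def wrongL3ArcDest : Set (Nbr N.graph v) :=
  {u | ¬ ((own σ).l3Arc u = true ↔ hasL3Arc σ u)}

/-! Layer 4 -/

def wrongArcDest : Set (Nbr N.graph v) :=
  {u | (own σ).l3Arc u = false ∧ (own σ).arc u = true}

def branchChild : Set (Nbr N.graph v) :=
  {u | (nbr σ u).l1Parent.1 = v ∧ (nbr σ u).l4Branch = true}

def isBranch : Prop :=
  (own σ).l1Color = true ∧
    ((blueChild σ).Nonempty ∨
      ((branchChild σ = redChild σ ∧ (redChild σ).Nonempty) ∧ v ∉ N.targets))

def removalRule1 (u : Nbr N.graph v) : Prop :=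
  u ∈ branchChild σ ∧ branchChild σ ⊂ redChild σ

noncomputable def minBranchChild : CNbr N.graph v := minLabel N v (branchChild σ)

def removalRule2 (u : Nbr N.graph v) : Prop :=
  u ∈ branchChild σ ∧ branchChild σ = redChild σ ∧ u.1 ≠ (minBranchChild σ).1

def removalRule3 (u : Nbr N.graph v) : Prop :=
  u ∈ branchChild σ ∧ branchChild σ = redChild σ ∧ v ∈ N.targets

/-- The parent of `v` in the layer 1 tree is another node, which has no arc to `v`, and `v` has no
blue child. -/
def removalRule4 : Prop :=
  (own σ).l1Parent.1 ≠ v ∧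
    (∀ h : N.graph.Adj (own σ).l1Parent.1 v, (σ (own σ).l1Parent).arc ⟨v, h⟩ = false) ∧
    blueChild σ = ∅

def isRedundant (u : Nbr N.graph v) : Prop :=
  removalRule1 σ u ∨ removalRule2 σ u ∨ removalRule3 σ u ∨ removalRule4 σ

def missingArcDest : Set (Nbr N.graph v) :=
  {u | ¬ isRedundant σ u ∧ (own σ).arc u = false ∧ (own σ).l3Arc u = true}

def redundantArcDest : Set (Nbr N.graph v) :=
  {u | isRedundant σ u ∧ (own σ).arc u = true}

end Macros

section Layers

variable {V : Type*} (N : Network V)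

open Classical in
/-- Layer 1: BFS trees rooted at the senders, and the red colour. -/
noncomputable def l1SpanningForest : Algorithm N.graph (NodeState N) :=
  prioritize
    [ { guard := fun _ σ => (own σ).l1Dist ≠ l1CorrectDist σ
        statement := fun _ σ => { own σ with l1Dist := l1CorrectDist σ } },
      { guard := fun _ σ => (own σ).l1Parent ≠ l1CorrectParent σ
        statement := fun _ σ => { own σ with l1Parent := l1CorrectParent σ } },
      { guard := fun _ σ => ¬ ((own σ).l1Color = true ↔ isRed σ)
        statement := fun _ σ => { own σ with l1Color := decide (isRed σ) } } ]

open Classical in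
/-- Layer 2: BFS trees rooted at the red nodes, and the blue colour. -/
noncomputable def l2SpanningForest : Algorithm N.graph (NodeState N) :=
  prioritize
    [ { guard := fun _ σ => (own σ).l2Dist ≠ l2CorrectDist σ
        statement := fun _ σ => { own σ with l2Dist := l2CorrectDist σ } },
      { guard := fun _ σ => (own σ).l2Parent ≠ l2CorrectParent σ
        statement := fun _ σ => { own σ with l2Parent := l2CorrectParent σ } },
      { guard := fun _ σ => ¬ ((own σ).l2Color = true ↔ isBlue σ)
        statement := fun _ σ => { own σ with l2Color := decide (isBlue σ) } } ]

open Classical in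
/-- Layer 3: a possibly non-minimal weakly ST-reachable DAG. -/
noncomputable def l3WSTDAG : Algorithm N.graph (NodeState N) :=
  prioritize
    [ { guard := fun _ σ => (wrongL3ArcDest σ).Nonempty
        statement := fun _ σ =>
          { own σ with
            l3Arc := fun u =>
              if u ∈ wrongL3ArcDest σ then decide (hasL3Arc σ u) else (own σ).l3Arc u } } ]

open Classical in
/-- Layer 4: removal of redundant arcs. -/
noncomputable def l4RedundantArcRemoval : Algorithm N.graph (NodeState N) :=
  prioritize
    [ { guard := fun _ σ => (wrongArcDest σ).Nonempty
        statement := fun _ σ =>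
          { own σ with
            arc := fun u => if u ∈ wrongArcDest σ then false else (own σ).arc u } },
      { guard := fun _ σ => ¬ ((own σ).l4Branch = true ↔ isBranch σ)
        statement := fun _ σ => { own σ with l4Branch := decide (isBranch σ) } },
      { guard := fun _ σ => (missingArcDest σ).Nonempty
        statement := fun _ σ =>
          { own σ with
            arc := fun u => if u ∈ missingArcDest σ then true else (own σ).arc u } },
      { guard := fun _ σ => (redundantArcDest σ).Nonempty
        statement := fun _ σ =>
          { own σ with
            arc := fun u => if u ∈ redundantArcDest σ then false else (own σ).arc u } } ]

/-- Algorithm MWSTDAG: the hierarchical collateral composition of the four layers. -/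
noncomputable def mwstdag : Algorithm N.graph (NodeState N) :=
  compose (l4RedundantArcRemoval N)
    (compose (l3WSTDAG N) (compose (l2SpanningForest N) (l1SpanningForest N)))

/-- The states in which both distance variables are at most `M`. -/
def distAtMost (M : ℕ) (v : V) : Set (NodeState N v) :=
  {q | q.l1Dist ≤ M ∧ q.l2Dist ≤ M}

end Layers

end MWST

/-! The values to which the variables must converge are determined by the graph alone, so
combinatorics and dynamics separate. `Red`, `Blue`, `WeakArc`, `Branch` and `FinalArc` describe
these values, `Stable` says that a configuration has them, and stable and final configurations
coincide.

The limit digraph carries red arcs away from the senders along shortest-path trees and blue arcs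
from the remaining senders to the nearest red nodes. It is acyclic because a potential drops along
every arc. A branch node is one below which all targets are supplied by blue paths, so the layer 1
arc into it serves only to give its parent a way to a target. Such an arc is dropped when the parent
is a target or has a better child, and nodes thereby left without supply (not `Served`) lose their
arcs too. Served red nodes still keep a way down, and targets remain served. For minimality, an arc
that was kept is either the only exit of its tail, and then some sender is stuck above it
(`Served.exists_stuck_sender`, `Blue.exists_stuck_sender`), or it leads to a non-branch node whose
only entry it is, and then some target below is cut off (`exists_unreached_target`).

For the dynamics, `Attains r P` means that `P` holds forever after `r` rounds. If every possible
move under `P`, including idling while disabled, yields a local property, one more round yields it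
everywhere (`Attains.succ`). Iterating this costs about `D` rounds for each distance, colour or
branch variable, and two rounds per tree level for the last arcs. In total `7 * D + 11` rounds
suffice.

Memory is bounded by an invariant: an initial excess `M` can only be carried along shortest paths,
so no distance variable exceeds `M + D`. -/

namespace MWST

/-! ### Outcomes of single moves and induction over rounds -/

section Execution

variable {V : Type*} {G : SimpleGraph V} {Q : V → Type*} {A B : Algorithm G Q}

/-- `q` is a possible next state of `v` when `v` is scheduled in `C`. -/
def Outcome (A : Algorithm G Q) (C : Config Q) (v : V) (q : Q v) : Prop :=
  (∃ a ∈ A, a.guard v (view G C v) ∧ q = a.statement v (view G C v)) ∨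
    (¬ Enabled A C v ∧ q = C v)

theorem Step.outcome {X : Set V} {C C' : Config Q} (h : Step A X C C') {v : V} (hv : v ∈ X) :
    Outcome A C v (C' v) := by
  by_cases he : Enabled A C v
  · exact Or.inl ((h v).1 hv he)
  · exact Or.inr ⟨he, (h v).2 fun h' => he h'.2⟩

theorem Step.eq_of_notMem {X : Set V} {C C' : Config Q} (h : Step A X C C') {v : V}
    (hv : v ∉ X) : C' v = C v :=
  (h v).2 fun h' => hv h'.1

/-- By fairness each node is scheduled again after `t`; finiteness of `V` bounds these times
uniformly, so every round ends. -/
theorem exists_coversRound [Finite V] {S : ℕ → Set V} (hS : IsFair S) (Ξ : ℕ → Config Q) (t : ℕ) :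
    ∃ t', t ≤ t' ∧ CoversRound A S Ξ t t' := by
  choose i hi hiS using fun v => hS v t
  obtain ⟨M, hM⟩ := (Set.finite_range i).bddAbove
  refine ⟨max t (M + 1), le_max_left _ _, fun v _ => ⟨i v, hi v, ?_, Or.inl (hiS v)⟩⟩
  exact lt_max_of_lt_right (Nat.lt_succ_of_le (hM ⟨v, rfl⟩))

theorem exists_isLeast_coversRound [Finite V] {S : ℕ → Set V} (hS : IsFair S)
    (Ξ : ℕ → Config Q) (t : ℕ) :
    ∃ t', IsLeast {r | t ≤ r ∧ CoversRound A S Ξ t r} t' :=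
  ⟨_, Nat.sInf_mem (exists_coversRound hS Ξ t), fun _ h => Nat.sInf_le h⟩

/-- After `r` rounds of any fair execution, `P` holds forever. -/
def Attains (A : Algorithm G Q) (r : ℕ) (P : Config Q → Prop) : Prop :=
  ∀ S Ξ, IsFair S → IsExecution A S Ξ → ∃ t, RoundEnd A S Ξ r t ∧ ∀ i, t ≤ i → P (Ξ i)

theorem attains_zero : Attains A 0 fun _ => True :=
  fun _ _ _ _ => ⟨0, .zero, fun _ _ => trivial⟩

theorem Attains.mono {r : ℕ} {P P' : Config Q → Prop} (h : Attains A r P)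
    (hP : ∀ C, P C → P' C) : Attains A r P' := fun S Ξ hS hΞ =>
  let ⟨t, ht, hi⟩ := h S Ξ hS hΞ
  ⟨t, ht, fun i hti => hP _ (hi i hti)⟩

/-- If every action performed under `P` establishes `R`, then one more round establishes `R`
everywhere. -/
theorem Attains.succ [Finite V] {r : ℕ} {P : Config Q → Prop} (h : Attains A r P)
    (R : ∀ v, Q v → Prop) (hR : ∀ C, P C → ∀ v q, Outcome A C v q → R v q) :
    Attains A (r + 1) fun C => P C ∧ ∀ v, R v (C v) := by
  intro S Ξ hS hΞ
  obtain ⟨t, ht, hP⟩ := h S Ξ hS hΞ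
  obtain ⟨t', ht'⟩ := exists_isLeast_coversRound (A := A) hS Ξ t
  refine ⟨t', .succ ht ht', fun i hi => ⟨hP i (ht'.1.1.trans hi), fun v => ?_⟩⟩
  -- Once `R` holds at `v` it persists: any move of `v` establishes it again, and without a move the
  -- state is unchanged.
  have keep : ∀ j, t ≤ j → R v (Ξ j v) → ∀ k, j ≤ k → R v (Ξ k v) := by
    intro j hj hRj k hk
    induction k, hk using Nat.le_induction with
    | base => exact hRj
    | succ k hk ih =>
      by_cases hv : v ∈ S k
      · exact hR _ (hP k (hj.trans hk)) v _ ((hΞ.2 k).outcome hv)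
      · rwa [(hΞ.2 k).eq_of_notMem hv]
  by_cases he : Enabled A (Ξ t) v
  · obtain ⟨j, hj, hjt, hv | hv⟩ := ht'.1.2 v he
    · exact keep (j + 1) (by omega) (hR _ (hP j hj) v _ ((hΞ.2 j).outcome hv)) i (by omega)
    · exact keep (j + 1) (by omega) (hR _ (hP _ (by omega)) v _ (Or.inr ⟨hv.2, rfl⟩)) i (by omega)
  -- A disabled node satisfies `R` already, since keeping its state counts as an outcome.
  · exact keep t le_rfl (hR _ (hP t le_rfl) v _ (Or.inr ⟨he, rfl⟩)) i (ht'.1.1.trans hi)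

/-- One application of `Attains.succ` per stage. The property may sharpen with `k`, as
approximations of distances do, and stage `0` must be vacuous because the initial configuration is
arbitrary. -/
theorem Attains.iterate [Finite V] {r : ℕ} {P : Config Q → Prop} (h : Attains A r P)
    (R : ℕ → ∀ v, Q v → Prop) (h0 : ∀ v q, R 0 v q)
    (hR : ∀ k C, P C → (∀ v, R k v (C v)) → ∀ v q, Outcome A C v q → R (k + 1) v q) (k : ℕ) :
    Attains A (r + k) fun C => P C ∧ ∀ v, R k v (C v) := by
  induction k with
  | zero => exact h.mono fun C hC => ⟨hC, fun v => h0 v _⟩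
  | succ k ih =>
    exact (ih.succ (R (k + 1)) fun C hC => hR k C hC.1 hC.2).mono fun C hC => ⟨hC.1.1, hC.2⟩

/-- A local property that is established by an action as soon as it holds at all lower levels is
established everywhere, one level per round. -/
theorem Attains.levels [Finite V] {r : ℕ} {P : Config Q → Prop} (h : Attains A r P)
    (lev : V → ℕ) (D : ℕ) (hD : ∀ v, lev v ≤ D) (R : ∀ v, Q v → Prop)
    (hR : ∀ C, P C → ∀ v q, Outcome A C v q → (∀ u, lev u < lev v → R u (C u)) → R v q) :
    Attains A (r + (D + 1)) fun C => P C ∧ ∀ v, R v (C v) :=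
  (h.iterate (fun k v q => lev v < k → R v q) (by simp)
    (fun _ C hC hk v q hq hv => hR C hC v q hq fun u hu => hk u (by omega)) (D + 1)).mono
    fun _ hC => ⟨hC.1, fun v => hC.2 v (Nat.lt_succ_of_le (hD v))⟩

theorem Step.of_outcome {X : Set V} {C : Config Q}
    (h : ∀ v q, Outcome A C v q → q = C v) : Step A X C C := fun v =>
  ⟨fun _ ⟨a, ha, hg⟩ => ⟨a, ha, hg, (h v _ (Or.inl ⟨a, ha, hg, rfl⟩)).symm⟩, fun _ => rfl⟩

theorem Step.eq_of_outcome {X : Set V} {C C' : Config Q} (hs : Step A X C C')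
    (h : ∀ v q, Outcome A C v q → q = C v) : C' = C := by
  funext v
  by_cases hv : v ∈ X
  · exact h v _ (hs.outcome hv)
  · exact hs.eq_of_notMem hv

/-- A property that is eventually attained holds in every final configuration. -/
theorem IsFinal.of_attains [Nonempty V] {r : ℕ} {P : Config Q → Prop} (h : Attains A r P)
    {C : Config Q} (hC : IsFinal A C) : P C := by
  -- A final configuration repeated forever, with all nodes always scheduled, is a fair execution.
  obtain ⟨t, -, ht⟩ := h (fun _ => Set.univ) (fun _ => C) (fun _ n => ⟨n, le_rfl, trivial⟩)
    ⟨fun _ => Set.univ_nonempty, fun _ => hC _ Set.univ_nonempty⟩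
  exact ht t le_rfl

/-! ### Priorities -/

/-- `q` is the result of the first action of the list whose guard holds, and `K` holds if there is
no such action. -/
def FirstOutcome (C : Config Q) (v : V) (q : Q v) : Algorithm G Q → Prop → Prop
  | [], K => K
  | a :: l, K => (a.guard v (view G C v) ∧ q = a.statement v (view G C v)) ∨
      (¬ a.guard v (view G C v) ∧ FirstOutcome C v q l K)

variable {C : Config Q} {v : V} {q : Q v}

theorem enabled_compose : Enabled (compose B A) C v ↔ Enabled A C v ∨ Enabled B C v := by
  constructor
  · rintro ⟨a, ha, hg⟩
    rcases List.mem_append.1 ha with ha | ha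
    · exact Or.inl ⟨a, ha, hg⟩
    · obtain ⟨b, hb, rfl⟩ := List.mem_map.1 ha
      exact Or.inr ⟨b, hb, hg.2⟩
  · intro h
    by_cases hA : Enabled A C v
    · obtain ⟨a, ha, hg⟩ := hA
      exact ⟨a, List.mem_append_left _ ha, hg⟩
    · obtain ⟨b, hb, hg⟩ := h.resolve_left hA
      exact ⟨_, List.mem_append_right _ (List.mem_map.2 ⟨b, hb, rfl⟩), hA, hg⟩

theorem Outcome.compose (h : Outcome (compose B A) C v q) :
    (Enabled A C v ∧ Outcome A C v q) ∨ (¬ Enabled A C v ∧ Outcome B C v q) := by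
  rcases h with ⟨a, ha, hg, hq⟩ | ⟨he, hq⟩
  · rcases List.mem_append.1 ha with ha | ha
    · exact Or.inl ⟨⟨a, ha, hg⟩, Or.inl ⟨a, ha, hg, hq⟩⟩
    · obtain ⟨b, hb, rfl⟩ := List.mem_map.1 ha
      exact Or.inr ⟨hg.1, Or.inl ⟨b, hb, hg.2, hq⟩⟩
  · rw [enabled_compose, not_or] at he
    exact Or.inr ⟨he.1, Or.inr ⟨he.2, hq⟩⟩

theorem enabled_singleton {a : GuardedAction G Q} :
    Enabled [a] C v ↔ a.guard v (view G C v) := by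
  simp [Enabled]

theorem Outcome.singleton {a : GuardedAction G Q} (h : Outcome [a] C v q)
    (hg : a.guard v (view G C v)) : q = a.statement v (view G C v) := by
  rcases h with ⟨b, hb, -, hq⟩ | ⟨he, -⟩
  · rwa [← List.mem_singleton.1 hb]
  · exact absurd (enabled_singleton.2 hg) he

/-- Unfolds the nested strengthened guards into one decision list. The proposition `K` stands for
what happens when the whole list is disabled, which lets the layers be chained. -/
theorem FirstOutcome.of_prioritize {l : Algorithm G Q} {K : Prop}
    (h : (Enabled (prioritize l) C v ∧ Outcome (prioritize l) C v q) ∨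
      (¬ Enabled (prioritize l) C v ∧ K)) : FirstOutcome C v q l K := by
  induction l with
  | nil =>
    rcases h with ⟨⟨a, ha, -⟩, -⟩ | h
    · simp [prioritize] at ha
    · exact h.2
  | cons a l ih =>
    by_cases hg : a.guard v (view G C v)
    · refine Or.inl ⟨hg, ?_⟩
      rcases h with ⟨-, h⟩ | ⟨h, -⟩
      · rcases h.compose with h | h
        · exact h.2.singleton hg
        · exact absurd (enabled_singleton.2 hg) h.1
      · exact absurd (enabled_compose.2 (Or.inl (enabled_singleton.2 hg))) h
    · refine Or.inr ⟨hg, ih ?_⟩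
      rcases h with ⟨he, h⟩ | ⟨h, hK⟩
      · have he' := (enabled_compose.1 he).resolve_left (mt enabled_singleton.1 hg)
        rcases h.compose with h | h
        · exact absurd (enabled_singleton.1 h.1) hg
        · exact Or.inl ⟨he', h.2⟩
      · exact Or.inr ⟨fun h' => h (enabled_compose.2 (Or.inr h')), hK⟩

end Execution

/-! ### Shortest-path forests towards a set of nodes -/

section Trees

variable {V : Type*} (N : Network V)

theorem minLabel_mem {v : V} {P : Set (Nbr N.graph v)} (h : P.Nonempty) :
    ∃ u ∈ P, (minLabel N v P).1 = u.1 := by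
  rw [minLabel, dif_pos h]
  exact ⟨_, Function.argminOn_mem (N.label v) P h, rfl⟩

theorem Network.nontrivial {V : Type*} (N : Network V) : Nontrivial V := by
  obtain ⟨s, hs⟩ := N.senders_nonempty
  obtain ⟨t, ht⟩ := N.targets_nonempty
  exact ⟨s, t, fun h => Set.disjoint_left.1 N.disjoint hs (h ▸ ht)⟩

theorem Network.nonempty_nbr {V : Type*} (N : Network V) (v : V) : Nonempty (Nbr N.graph v) :=
  have := N.nontrivial
  let ⟨u, hu⟩ := N.connected.preconnected.exists_adj_of_nontrivial v
  ⟨⟨u, hu⟩⟩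

/-- The distance from `v` to a set of nodes. -/
noncomputable def distTo (X : Set V) (v : V) : ℕ := ⨅ x : X, N.graph.dist v x

variable {N} {X : Set V}

theorem distTo_le_dist {v x : V} (hx : x ∈ X) : distTo N X v ≤ N.graph.dist v x :=
  ciInf_le' (fun x : X => N.graph.dist v x) ⟨x, hx⟩

theorem exists_distTo_eq (hX : X.Nonempty) (v : V) :
    ∃ x ∈ X, distTo N X v = N.graph.dist v x := by
  have := hX.to_subtype
  obtain ⟨x, hx⟩ := Set.mem_range.1 (Nat.sInf_mem (Set.range_nonempty fun x : X => N.graph.dist v x))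
  exact ⟨x, x.2, hx.symm⟩

theorem distTo_eq_zero {v : V} (hv : v ∈ X) : distTo N X v = 0 :=
  Nat.le_zero.1 ((distTo_le_dist hv).trans_eq SimpleGraph.dist_self)

theorem distTo_le_succ (hX : X.Nonempty) {v u : V} (h : N.graph.Adj v u) :
    distTo N X v ≤ distTo N X u + 1 := by
  obtain ⟨x, hx, hd⟩ := exists_distTo_eq (N := N) hX u
  have := N.connected.dist_triangle (u := v) (v := u) (w := x)
  rw [SimpleGraph.dist_eq_one_iff_adj.2 h] at this
  have := distTo_le_dist (N := N) (v := v) hx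
  omega

theorem exists_distTo_succ (hX : X.Nonempty) {v : V} (hv : v ∉ X) :
    ∃ u : Nbr N.graph v, distTo N X u.1 + 1 = distTo N X v := by
  obtain ⟨x, hx, hd⟩ := exists_distTo_eq (N := N) hX v
  obtain ⟨p, hp⟩ := N.connected.exists_walk_length_eq_dist v x
  cases p with
  | nil => exact absurd hx hv
  | @cons _ u _ h p =>
    refine ⟨⟨u, h⟩, le_antisymm ?_ (distTo_le_succ hX h)⟩
    have h1 := distTo_le_dist (N := N) (v := u) hx |>.trans (SimpleGraph.dist_le p)
    change distTo N X u + 1 ≤ _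
    rw [SimpleGraph.Walk.length_cons] at hp
    omega

/-- The true distances satisfy the local rule by which layers 1 and 2 compute their distance
variables. -/
theorem iInf_distTo (hX : X.Nonempty) {v : V} (hv : v ∉ X) :
    (⨅ u : Nbr N.graph v, distTo N X u.1) + 1 = distTo N X v := by
  obtain ⟨u, hu⟩ := exists_distTo_succ (N := N) hX hv
  rw [← hu, Nat.add_right_cancel_iff]
  have : Nonempty (Nbr N.graph v) := ⟨u⟩
  refine le_antisymm (ciInf_le' (fun u : Nbr N.graph v => distTo N X u.1) u)
    (le_ciInf fun w => ?_)
  have := distTo_le_succ (N := N) hX w.2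
  omega

theorem distTo_le_diam [Finite V] (hX : X.Nonempty) (v : V) : distTo N X v ≤ N.diam := by
  have := N.nontrivial
  obtain ⟨x, hx⟩ := hX
  exact (distTo_le_dist hx).trans
    (SimpleGraph.dist_le_diam (SimpleGraph.connected_iff_ediam_ne_top.1 N.connected))

theorem Network.one_le_diam {V : Type*} [Finite V] (N : Network V) : 1 ≤ N.diam := by
  have := N.nontrivial
  exact Nat.one_le_iff_ne_zero.2 (SimpleGraph.connected_iff_diam_ne_zero.1 N.connected)

variable (N X) in
open Classical in
/-- The parent of `v` in the forest of shortest paths to `X`. -/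
noncomputable def bfsParent (v : V) : CNbr N.graph v :=
  if v ∈ X then self N v
  else minLabel N v {u | ∀ w : Nbr N.graph v, distTo N X u.1 ≤ distTo N X w.1}

theorem bfsParent_of_mem {v : V} (hv : v ∈ X) : (bfsParent N X v).1 = v := by
  rw [bfsParent, if_pos hv]; rfl

theorem bfsParent_of_notMem (hX : X.Nonempty) {v : V} (hv : v ∉ X) :
    N.graph.Adj v (bfsParent N X v).1 ∧ distTo N X (bfsParent N X v).1 + 1 = distTo N X v := by
  obtain ⟨u, hu⟩ := exists_distTo_succ (N := N) hX hv
  rw [bfsParent, if_neg hv]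
  obtain ⟨w, hw, h⟩ := minLabel_mem N
    (P := {u | ∀ w : Nbr N.graph v, distTo N X u.1 ≤ distTo N X w.1})
    ⟨u, fun w => by have := distTo_le_succ (N := N) hX w.2; omega⟩
  rw [h]
  have := hw u
  have := distTo_le_succ (N := N) hX w.2
  exact ⟨w.2, by omega⟩

theorem bfsParent_eq_self (hX : X.Nonempty) {v : V} : (bfsParent N X v).1 = v ↔ v ∈ X :=
  ⟨fun h => by_contra fun hv => (bfsParent_of_notMem hX hv).1.ne h.symm, bfsParent_of_mem⟩

theorem distTo_of_child (hX : X.Nonempty) {v u : V} (ha : N.graph.Adj v u)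
    (h : (bfsParent N X u).1 = v) : distTo N X u = distTo N X v + 1 := by
  have hu : u ∉ X := fun hu => ha.ne ((bfsParent_of_mem hu).symm.trans h).symm
  rw [← (bfsParent_of_notMem hX hu).2, h]

end Trees

/-! ### The final values of the variables -/

section Values

variable {V : Type*} (N : Network V)

/-- The parent of `v` in the layer 1 tree. -/
noncomputable def senderParent (v : V) : V := (bfsParent N N.senders v).1

/-- The nodes of the layer 1 trees that have a target among their descendants. -/
inductive Red : V → Prop
  | target {v : V} : v ∈ N.targets → Red v
  | child {v u : V} : N.graph.Adj v u → senderParent N u = v → Red u → Red v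

/-- The parent of `v` in the layer 2 tree. -/
noncomputable def redParent (v : V) : V := (bfsParent N {v | Red N v} v).1

/-- The nodes that are not red and lie on the layer 2 path of some sender. -/
inductive Blue : V → Prop
  | sender {v : V} : ¬ Red N v → v ∈ N.senders → Blue v
  | child {v u : V} : ¬ Red N v → N.graph.Adj v u → redParent N u = v → Blue u → Blue v

def RedChild (v u : V) : Prop := N.graph.Adj v u ∧ senderParent N u = v ∧ Red N u

def BlueChild (v u : V) : Prop := N.graph.Adj v u ∧ redParent N u = v ∧ Blue N u

/-- The arcs of the digraph built by layer 3. -/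
def WeakArc (v u : V) : Prop :=
  (Red N v ∧ RedChild N v u) ∨ (Blue N v ∧ redParent N v = u)

/-- The red nodes below which every target can be reached from a blue sender. -/
inductive Branch : V → Prop
  | entry {v u : V} : Red N v → BlueChild N v u → Branch v
  | all {v u : V} : Red N v → v ∉ N.targets → RedChild N v u →
      (∀ w, RedChild N v w → Branch w) → Branch v

/-- The branch child of minimum label. -/
noncomputable def leastBranchChild (v : V) : V :=
  (minLabel N v {u | senderParent N u.1 = v ∧ Branch N u.1}).1

/-- The arc from `v` to its child `u` is not needed to reach a target. -/
def Droppable (v u : V) : Prop :=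
  (senderParent N u = v ∧ Branch N u) ∧
    ((∃ w, RedChild N v w ∧ ¬ Branch N w) ∨ u ≠ leastBranchChild N v ∨ v ∈ N.targets)

/-- The arcs of the digraph built by layer 4. -/
inductive FinalArc : V → V → Prop
  | source {v u : V} : WeakArc N v u → ¬ Droppable N v u →
      (senderParent N v = v ∨ ∃ w, BlueChild N v w) → FinalArc v u
  | next {v u : V} : WeakArc N v u → ¬ Droppable N v u →
      FinalArc (senderParent N v) v → FinalArc v u

/-- `v` is reached by an arc of the final digraph or is the root of a layer 1 tree. -/
def Served (v : V) : Prop :=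
  senderParent N v = v ∨ (∃ w, BlueChild N v w) ∨ FinalArc N (senderParent N v) v

variable {N} {v u : V}

/-- The inductive predicate satisfies the local rule of the algorithm with equality. `blue_iff`,
`branch_iff` and `finalArc_iff` play the same role for the other variables. -/
theorem red_iff : Red N v ↔ v ∈ N.targets ∨ ∃ u, RedChild N v u := by
  constructor
  · rintro (h | ⟨ha, hp, hu⟩)
    · exact Or.inl h
    · exact Or.inr ⟨_, ha, hp, hu⟩
  · rintro (h | ⟨u, ha, hp, hu⟩)
    · exact .target h
    · exact .child ha hp hu

theorem blue_iff : Blue N v ↔ ¬ Red N v ∧ (v ∈ N.senders ∨ ∃ u, BlueChild N v u) := by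
  constructor
  · rintro (⟨h, hs⟩ | ⟨h, ha, hp, hu⟩)
    · exact ⟨h, Or.inl hs⟩
    · exact ⟨h, Or.inr ⟨_, ha, hp, hu⟩⟩
  · rintro ⟨h, hs | ⟨u, ha, hp, hu⟩⟩
    · exact .sender h hs
    · exact .child h ha hp hu

theorem Blue.not_red (h : Blue N v) : ¬ Red N v := (blue_iff.1 h).1

theorem branch_iff : Branch N v ↔ Red N v ∧ ((∃ u, BlueChild N v u) ∨
    ((∀ w, RedChild N v w → Branch N w) ∧ (∃ u, RedChild N v u)) ∧ v ∉ N.targets) := by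
  constructor
  · rintro (⟨h, hu⟩ | ⟨h, ht, hu, hw⟩)
    · exact ⟨h, Or.inl ⟨_, hu⟩⟩
    · exact ⟨h, Or.inr ⟨⟨hw, _, hu⟩, ht⟩⟩
  · rintro ⟨h, ⟨u, hu⟩ | ⟨⟨hw, u, hu⟩, ht⟩⟩
    · exact .entry h hu
    · exact .all h ht hu hw

theorem Branch.red (h : Branch N v) : Red N v := (branch_iff.1 h).1

theorem finalArc_iff :
    FinalArc N v u ↔ WeakArc N v u ∧ ¬ Droppable N v u ∧ Served N v := by
  constructor
  · rintro (⟨h, hd, h' | h'⟩ | ⟨h, hd, h'⟩)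
    · exact ⟨h, hd, Or.inl h'⟩
    · exact ⟨h, hd, Or.inr (Or.inl h')⟩
    · exact ⟨h, hd, Or.inr (Or.inr h')⟩
  · rintro ⟨h, hd, h' | h' | h'⟩
    · exact .source h hd (Or.inl h')
    · exact .source h hd (Or.inr h')
    · exact .next h hd h'

theorem red_nonempty : {v | Red N v}.Nonempty :=
  N.targets_nonempty.mono fun _ => .target

theorem senderParent_eq_self : senderParent N v = v ↔ v ∈ N.senders :=
  bfsParent_eq_self N.senders_nonempty

theorem adj_redParent (h : ¬ Red N v) : N.graph.Adj v (redParent N v) :=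
  (bfsParent_of_notMem red_nonempty h).1

theorem adj_senderParent (h : v ∉ N.senders) : N.graph.Adj (senderParent N v) v :=
  (bfsParent_of_notMem N.senders_nonempty h).1.symm

theorem RedChild.dist (h : RedChild N v u) :
    distTo N N.senders u = distTo N N.senders v + 1 :=
  distTo_of_child N.senders_nonempty h.1 h.2.1

theorem redChild_senderParent (h : Red N v) (hv : v ∉ N.senders) :
    RedChild N (senderParent N v) v :=
  ⟨adj_senderParent hv, rfl, h⟩

theorem RedChild.red (h : RedChild N v u) : Red N v := .child h.1 h.2.1 h.2.2

theorem RedChild.notMem_senders (h : RedChild N v u) : u ∉ N.senders := fun hu =>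
  h.1.ne (h.2.1.symm.trans (senderParent_eq_self.2 hu))

theorem Blue.blueChild_redParent (h : Blue N v) : BlueChild N (redParent N v) v :=
  ⟨(adj_redParent h.not_red).symm, rfl, h⟩

theorem Blue.redParent_blue (h : Blue N v) (hr : ¬ Red N (redParent N v)) :
    Blue N (redParent N v) :=
  .child hr (adj_redParent h.not_red).symm rfl h

theorem WeakArc.adj (h : WeakArc N v u) : N.graph.Adj v u := by
  rcases h with h | ⟨h, rfl⟩
  · exact h.2.1
  · exact adj_redParent h.not_red

theorem leastBranchChild_spec (h : ∃ u, N.graph.Adj v u ∧ senderParent N u = v ∧ Branch N u) :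
    RedChild N v (leastBranchChild N v) ∧ Branch N (leastBranchChild N v) := by
  obtain ⟨u, ha, hu⟩ := h
  obtain ⟨w, hw, h⟩ := minLabel_mem N
    (P := {u : Nbr N.graph v | senderParent N u.1 = v ∧ Branch N u.1}) ⟨⟨u, ha⟩, hu⟩
  rw [leastBranchChild, h]
  exact ⟨⟨w.2, hw.1, hw.2.red⟩, hw.2⟩

/-! ### The final digraph is a weakly reachable DAG -/

/-- A node with a branch child in the layer 1 tree is itself red, hence not blue. -/
theorem Blue.not_droppable (h : Blue N v) : ¬ Droppable N v u := fun hd =>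
  h.not_red (by
    obtain ⟨⟨rfl, hb⟩, -⟩ := hd
    by_cases hu : u ∈ N.senders
    · rw [senderParent_eq_self.2 hu]; exact hb.red
    · exact .child (adj_senderParent hu) rfl hb.red)

theorem Blue.finalArc (h : Blue N v) : FinalArc N v (redParent N v) :=
  .source (Or.inr ⟨h, rfl⟩) (h.not_droppable)
    ((blue_iff.1 h).2.imp_left senderParent_eq_self.2)

/-- A potential that decreases along the arcs. -/
theorem exists_potential :
    ∃ m : V → ℤ, ∀ v u, FinalArc N v u → m u < m v := by
  classical
  -- Blue arcs approach the red set and red arcs move away from the senders. The sign makes both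
  -- decrease, with blue nodes positive and red nodes nonpositive, so entering the red part also
  -- decreases.
  refine ⟨fun v => if Red N v then -(distTo N N.senders v : ℤ)
    else (distTo N {v | Red N v} v : ℤ), fun v u h => ?_⟩
  rcases (finalArc_iff.1 h).1 with ⟨hr, hc⟩ | ⟨hb, rfl⟩
  · simp only [hr, hc.2.2, if_true, hc.dist]
    push_cast; omega
  · have h1 := (bfsParent_of_notMem (N := N) red_nonempty hb.not_red).2
    change distTo N _ (redParent N v) + 1 = _ at h1
    simp only [hb.not_red, if_false]
    split_ifs <;> omega

theorem not_transGen_finalArc (v : V) : ¬ Relation.TransGen (FinalArc N) v v := by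
  obtain ⟨m, hm⟩ := exists_potential (N := N)
  have key : ∀ u, Relation.TransGen (FinalArc N) v u → m u < m v := by
    intro u h
    induction h with
    | single h => exact hm _ _ h
    | tail _ h ih => exact (hm _ _ h).trans ih
  exact fun h => (key v h).false

theorem RedChild.served_of_finalArc (h : RedChild N v u) (ha : FinalArc N v u) : Served N u := by
  obtain ⟨-, rfl, -⟩ := h
  exact Or.inr (Or.inr ha)

/-- Arcs to non-branch children are never droppable; if all red children are branch nodes, the arc
to the one of least label survives. -/
theorem Served.exists_red_arc (hs : Served N v) (hr : Red N v) (ht : v ∉ N.targets) :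
    ∃ u, RedChild N v u ∧ FinalArc N v u := by
  by_cases h : ∃ w, RedChild N v w ∧ ¬ Branch N w
  · obtain ⟨w, hw, hb⟩ := h
    exact ⟨w, hw, finalArc_iff.2 ⟨Or.inl ⟨hr, hw⟩, fun hd => hb hd.1.2, hs⟩⟩
  · obtain ⟨u, hu⟩ := (red_iff.1 hr).resolve_left ht
    have h' : ∀ w, RedChild N v w → Branch N w := fun w hw => by_contra fun hb => h ⟨w, hw, hb⟩
    have hm := leastBranchChild_spec ⟨u, hu.1, hu.2.1, h' u hu⟩
    refine ⟨_, hm.1, finalArc_iff.2 ⟨Or.inl ⟨hr, hm.1⟩, ?_, hs⟩⟩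
    rintro ⟨-, hd | hd | hd⟩
    exacts [h hd, hd rfl, ht hd]

theorem Served.reaches_target [Finite V] (hs : Served N v) (hr : Red N v) :
    ∃ t ∈ N.targets, Relation.ReflTransGen (FinalArc N) v t := by
  -- Red arcs increase the distance to the senders, which is at most the diameter.
  induction hn : N.diam - distTo N N.senders v using Nat.strong_induction_on generalizing v with
  | _ n ih =>
    by_cases ht : v ∈ N.targets
    · exact ⟨v, ht, .refl⟩
    · obtain ⟨u, hu, ha⟩ := hs.exists_red_arc hr ht
      have h1 := hu.dist
      have h2 := distTo_le_diam (N := N) N.senders_nonempty u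
      obtain ⟨t, ht, h⟩ := ih _ (by omega) (hu.served_of_finalArc ha) hu.2.2 rfl
      exact ⟨t, ht, .head ha h⟩

theorem Blue.reaches_target [Finite V] (h : Blue N v) :
    ∃ t ∈ N.targets, Relation.ReflTransGen (FinalArc N) v t := by
  induction hn : distTo N {v | Red N v} v using Nat.strong_induction_on generalizing v with
  | _ n ih =>
    have h1 := (bfsParent_of_notMem (N := N) red_nonempty h.not_red).2
    change distTo N _ (redParent N v) + 1 = _ at h1
    suffices ∃ t ∈ N.targets, Relation.ReflTransGen (FinalArc N) (redParent N v) t from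
      let ⟨t, ht, h'⟩ := this
      ⟨t, ht, .head h.finalArc h'⟩
    by_cases hr : Red N (redParent N v)
    · exact Served.reaches_target (Or.inr (Or.inl ⟨v, h.blueChild_redParent⟩)) hr
    · exact ih _ (by omega) (h.redParent_blue hr) rfl

theorem Blue.reached (h : Blue N v) :
    ∃ s ∈ N.senders, Relation.ReflTransGen (FinalArc N) s v := by
  induction h with
  | sender _ hs => exact ⟨_, hs, .refl⟩
  | child _ _ hp hu ih =>
    obtain ⟨s, hs, h⟩ := ih
    exact ⟨s, hs, h.tail (hp ▸ hu.finalArc)⟩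

/-- Climb the layer 1 tree: the tail of a final arc is served again, so the climb ends at a sender
or at a node entered by a blue path. -/
theorem Served.reached (h : Served N v) (hr : Red N v) :
    ∃ s ∈ N.senders, Relation.ReflTransGen (FinalArc N) s v := by
  induction hn : distTo N N.senders v using Nat.strong_induction_on generalizing v with
  | _ n ih =>
    by_cases hv : v ∈ N.senders
    · exact ⟨v, hv, .refl⟩
    rcases h with h | ⟨w, -, hp, hw⟩ | h
    · exact absurd (senderParent_eq_self.1 h) hv
    · obtain ⟨s, hs, h⟩ := hw.reached
      exact ⟨s, hs, h.tail (hp ▸ hw.finalArc)⟩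
    · have hc := redChild_senderParent hr hv
      have := hc.dist
      obtain ⟨s, hs, h'⟩ := ih _ (by omega) (finalArc_iff.1 h).2.2 hc.red rfl
      exact ⟨s, hs, h'.tail h⟩

/-- The parent is served: if it is a branch node, it must have a blue child, because its child `v`
is not a branch node; otherwise induction applies to it. The arc from the parent to `v` is not
droppable, as only arcs to branch nodes are. -/
theorem served_of_not_branch (hr : Red N v) (hb : ¬ Branch N v) : Served N v := by
  induction hn : distTo N N.senders v using Nat.strong_induction_on generalizing v with
  | _ n ih =>
    by_cases hv : v ∈ N.senders
    · exact Or.inl (senderParent_eq_self.2 hv)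
    have hc := redChild_senderParent hr hv
    have hd := hc.dist
    have hp : Served N (senderParent N v) := by
      by_cases hb' : Branch N (senderParent N v)
      · rcases (branch_iff.1 hb').2 with h | h
        · exact Or.inr (Or.inl h)
        · exact absurd (h.1.1 v hc) hb
      · exact ih _ (by omega) hc.red hb' rfl
    exact Or.inr (Or.inr (finalArc_iff.2 ⟨Or.inl ⟨hc.red, hc⟩, fun h => hb h.1.2, hp⟩))

/-- A target can be a branch node only through a blue child of its own. -/
theorem served_of_target (ht : v ∈ N.targets) : Served N v := by
  by_cases hb : Branch N v
  · rcases (branch_iff.1 hb).2 with h | h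
    · exact Or.inr (Or.inl h)
    · exact absurd ht h.2
  · exact served_of_not_branch (.target ht) hb

/-! ### Minimality -/

variable {r : V → V → Prop}

/-- A blue node is not a target and its only possible exit is its layer 2 parent. Throughout the
minimality argument `r` is an arbitrary subrelation of the final arcs, later the digraph with one
arc removed. -/
theorem stuck_of_blueChild (hr : ∀ v u, r v u → FinalArc N v u) (h : BlueChild N v u)
    (hv : ∀ t ∈ N.targets, ¬ Relation.ReflTransGen r v t) :
    ∀ t ∈ N.targets, ¬ Relation.ReflTransGen r u t := by
  intro t ht hut
  obtain ⟨-, hp, hu⟩ := h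
  rcases hut.cases_head with rfl | ⟨w, huw, hw⟩
  · exact hu.not_red (.target ht)
  · rcases (finalArc_iff.1 (hr _ _ huw)).1 with h1 | ⟨-, rfl⟩
    · exact hu.not_red h1.1
    · exact hv t ht (hp ▸ hw)

theorem Blue.exists_stuck_sender (hr : ∀ v u, r v u → FinalArc N v u) (h : Blue N v)
    (hv : ∀ t ∈ N.targets, ¬ Relation.ReflTransGen r v t) :
    ∃ s ∈ N.senders, ∀ t ∈ N.targets, ¬ Relation.ReflTransGen r s t := by
  induction h with
  | sender _ hs => exact ⟨_, hs, hv⟩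
  | child _ ha hp hu ih => exact ih (stuck_of_blueChild hr ⟨ha, hp, hu⟩ hv)

/-- A red node that is not a target and has no necessary child keeps a single outgoing arc. -/
theorem FinalArc.eq_leastBranchChild (h : FinalArc N v u) (hv : Red N v)
    (hb : ∀ w, RedChild N v w → Branch N w) : RedChild N v u ∧ u = leastBranchChild N v := by
  obtain ⟨hw, hd, -⟩ := finalArc_iff.1 h
  rcases hw with ⟨-, hc⟩ | ⟨hw, -⟩
  · exact ⟨hc, by_contra fun hn => hd ⟨⟨hc.2.1, hb u hc⟩, Or.inr (Or.inl hn)⟩⟩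
  · exact absurd hv hw.not_red

/-- Being stuck propagates towards a sender. If `v` is supplied by a blue child, it goes back along
a blue path. If it is supplied by its parent, then `v` is a branch node whose incoming arc was kept,
so the parent is not a target, has only branch children, and has that arc as its only exit; the
hypotheses recur one level up. -/
theorem Served.exists_stuck_sender (hr : ∀ v u, r v u → FinalArc N v u) (h : Served N v)
    (hv : Red N v) (ht : v ∉ N.targets) (hb : ∀ w, RedChild N v w → Branch N w)
    (hst : ∀ t ∈ N.targets, ¬ Relation.ReflTransGen r v t) :
    ∃ s ∈ N.senders, ∀ t ∈ N.targets, ¬ Relation.ReflTransGen r s t := by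
  induction hn : distTo N N.senders v using Nat.strong_induction_on generalizing v with
  | _ n ih =>
    by_cases hs : v ∈ N.senders
    · exact ⟨v, hs, hst⟩
    rcases h with h | ⟨w, hw⟩ | h
    · exact absurd (senderParent_eq_self.1 h) hs
    · exact hw.2.2.exists_stuck_sender hr (stuck_of_blueChild hr hw hst)
    · have hc := redChild_senderParent hv hs
      have hd := hc.dist
      have hvb : Branch N v :=
        branch_iff.2 ⟨hv, Or.inr ⟨⟨hb, (red_iff.1 hv).resolve_left ht⟩, ht⟩⟩
      obtain ⟨-, hnd, hps⟩ := finalArc_iff.1 h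
      have hpb : ∀ w, RedChild N (senderParent N v) w → Branch N w := fun w hw =>
        by_contra fun hwb => hnd ⟨⟨rfl, hvb⟩, Or.inl ⟨w, hw, hwb⟩⟩
      have hpt : senderParent N v ∉ N.targets := fun hpt =>
        hnd ⟨⟨rfl, hvb⟩, Or.inr (Or.inr hpt)⟩
      refine ih _ (by omega) hps hc.red hpt hpb (fun t htt hpr => ?_) rfl
      rcases hpr.cases_head with rfl | ⟨w, hpw, hw⟩
      · exact hpt htt
      · have h1 := ((hr _ _ hpw).eq_leastBranchChild hc.red hpb).2
        have h2 := (h.eq_leastBranchChild hc.red hpb).2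
        exact hst t htt (h2.trans h1.symm ▸ hw)

/-- A blue arc into the red node `u` would make it a branch node, so only the tree arc can enter. -/
theorem eq_parent_of_arc_to_not_branch {w : V} (h : FinalArc N w u) (hc : RedChild N v u)
    (hb : ¬ Branch N u) : w = v := by
  rcases (finalArc_iff.1 h).1 with ⟨-, hw⟩ | ⟨hw, rfl⟩
  · exact hw.2.1.symm.trans hc.2.1
  · exact absurd (.entry hc.2.2 hw.blueChild_redParent) hb

/-- A node below which some target depends on the layer 1 tree only. -/
theorem exists_unreached_target [Finite V] (hr : ∀ v u, r v u → FinalArc N v u)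
    (hv : Red N v) (hb : ¬ Branch N v)
    (hst : ∀ s ∈ N.senders, ¬ Relation.ReflTransGen r s v) :
    ∃ t ∈ N.targets, ∀ s ∈ N.senders, ¬ Relation.ReflTransGen r s t := by
  induction hn : N.diam - distTo N N.senders v using Nat.strong_induction_on generalizing v with
  | _ n ih =>
    by_cases ht : v ∈ N.targets
    · exact ⟨v, ht, hst⟩
    obtain ⟨u, hu⟩ := (red_iff.1 hv).resolve_left ht
    -- A non-branch node that is not a target has a non-branch red child, whose only entry is from
    -- `v`; unreachability descends until a target is met.
    obtain ⟨c, hc, hcb⟩ : ∃ c, RedChild N v c ∧ ¬ Branch N c := by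
      by_contra hcon
      exact hb (branch_iff.2 ⟨hv, Or.inr ⟨⟨fun w hw => by_contra fun hwb => hcon ⟨w, hw, hwb⟩,
        u, hu⟩, ht⟩⟩)
    have h1 := hc.dist
    have h2 := distTo_le_diam (N := N) N.senders_nonempty c
    refine ih _ (by omega) hc.2.2 hcb (fun s hs h => ?_) rfl
    rcases h.cases_tail with rfl | ⟨w, hsw, hw⟩
    · exact hc.notMem_senders hs
    · exact hst s hs (eq_parent_of_arc_to_not_branch (hr _ _ hw) hc hcb ▸ hsw)

/-- A red arc to a branch node and a blue arc are the only exits of their tails, so losing one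
strands a sender. A red arc to a non-branch node is the only entry of its head, so losing it
isolates a target. -/
theorem finalArc_minimal [Finite V] (hr : ∀ v u, r v u → FinalArc N v u) (h : FinalArc N v u)
    (hvu : ¬ r v u) :
    (∃ s ∈ N.senders, ∀ t ∈ N.targets, ¬ Relation.ReflTransGen r s t) ∨
      ∃ t ∈ N.targets, ∀ s ∈ N.senders, ¬ Relation.ReflTransGen r s t := by
  obtain ⟨hw, hd, hs⟩ := finalArc_iff.1 h
  rcases hw with ⟨hv, hc⟩ | ⟨hv, hp⟩
  · by_cases hb : Branch N u
    · left
      have hvb : ∀ w, RedChild N v w → Branch N w := fun w hw =>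
        by_contra fun hwb => hd ⟨⟨hc.2.1, hb⟩, Or.inl ⟨w, hw, hwb⟩⟩
      have hvt : v ∉ N.targets := fun hvt => hd ⟨⟨hc.2.1, hb⟩, Or.inr (Or.inr hvt)⟩
      refine hs.exists_stuck_sender hr hv hvt hvb fun t ht hvr => ?_
      rcases hvr.cases_head with rfl | ⟨w, hvw, -⟩
      · exact hvt ht
      · refine hvu ?_
        have h1 := ((hr _ _ hvw).eq_leastBranchChild hv hvb).2
        have h2 := (h.eq_leastBranchChild hv hvb).2
        rwa [h2, ← h1]
    · right
      refine exists_unreached_target hr hc.2.2 hb fun s hs h' => ?_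
      rcases h'.cases_tail with rfl | ⟨w, -, hw⟩
      · exact hc.notMem_senders hs
      · exact hvu (eq_parent_of_arc_to_not_branch (hr _ _ hw) hc hb ▸ hw)
  · left
    refine hv.exists_stuck_sender hr fun t ht hvr => ?_
    rcases hvr.cases_head with rfl | ⟨w, hvw, -⟩
    · exact hv.not_red (.target ht)
    · rcases (finalArc_iff.1 (hr _ _ hvw)).1 with h1 | ⟨-, rfl⟩
      · exact hv.not_red h1.1
      · exact hvu (hp ▸ hvw)

theorem isMinimal_of_arc_eq [Finite V] (H : DirSubgraph N.graph) (hV : H.verts = Set.univ)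
    (hH : H.arc = FinalArc N) : IsMinimalWeaklySTReachableDAG N H where
  senders_reach s hs := by
    have : ∃ t ∈ N.targets, Relation.ReflTransGen (FinalArc N) s t := by
      by_cases hr : Red N s
      · exact Served.reaches_target (Or.inl (senderParent_eq_self.2 hs)) hr
      · exact (Blue.sender hr hs).reaches_target
    obtain ⟨t, ht, h⟩ := this
    exact ⟨t, ht, hV ▸ trivial, hH ▸ h⟩
  targets_reached t ht := by
    obtain ⟨s, hs, h⟩ := (served_of_target ht).reached (.target ht)
    exact ⟨s, hs, hV ▸ trivial, hH ▸ h⟩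
  acyclic v := hH ▸ not_transGen_finalArc v
  minimal a b hab := by
    rintro ⟨h1, h2⟩
    have hr : ∀ v u, (H.removeArc a b).arc v u → FinalArc N v u := fun v u h => hH ▸ h.1
    rcases finalArc_minimal hr (hH ▸ hab) (fun h => h.2 ⟨rfl, rfl⟩) with
      ⟨s, hs, h⟩ | ⟨t, ht, h⟩
    · obtain ⟨t, ht, hst⟩ := h1 s hs
      exact h t ht hst.2
    · obtain ⟨s, hs, hst⟩ := h2 t ht
      exact h s hs hst.2

end Values

/-! ### Effect of a single move on each variable -/

section Actions

variable {V : Type*} {N : Network V} {v : V}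

/-- The variables of layer 1 are correct. -/
structure Layer1Correct (σ : View N.graph (NodeState N) v) : Prop where
  dist : (own σ).l1Dist = l1CorrectDist σ
  parent : (own σ).l1Parent = l1CorrectParent σ
  color : (own σ).l1Color = true ↔ isRed σ

/-- The variables of layer 2 are correct. -/
structure Layer2Correct (σ : View N.graph (NodeState N) v) : Prop where
  dist : (own σ).l2Dist = l2CorrectDist σ
  parent : (own σ).l2Parent = l2CorrectParent σ
  color : (own σ).l2Color = true ↔ isBlue σ

/-- The variables of the first three layers are correct. -/
structure Layer3Correct (σ : View N.graph (NodeState N) v) : Prop where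
  layer1 : Layer1Correct σ
  layer2 : Layer2Correct σ
  arc : ∀ u, (own σ).l3Arc u = true ↔ hasL3Arc σ u

variable {C : Config (NodeState N)} {q : NodeState N v}

-- The composition flattened into one decision list across the four layers, each layer being the
-- continuation of the one below it; idling is the last resort.
open Classical in
theorem Outcome.firstOutcome (h : Outcome (mwstdag N) C v q) :
    FirstOutcome C v q
      [ { guard := fun _ σ => (own σ).l1Dist ≠ l1CorrectDist σ
          statement := fun _ σ => { own σ with l1Dist := l1CorrectDist σ } },
        { guard := fun _ σ => (own σ).l1Parent ≠ l1CorrectParent σ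
          statement := fun _ σ => { own σ with l1Parent := l1CorrectParent σ } },
        { guard := fun _ σ => ¬ ((own σ).l1Color = true ↔ isRed σ)
          statement := fun _ σ => { own σ with l1Color := decide (isRed σ) } } ]
    (FirstOutcome C v q
      [ { guard := fun _ σ => (own σ).l2Dist ≠ l2CorrectDist σ
          statement := fun _ σ => { own σ with l2Dist := l2CorrectDist σ } },
        { guard := fun _ σ => (own σ).l2Parent ≠ l2CorrectParent σ
          statement := fun _ σ => { own σ with l2Parent := l2CorrectParent σ } },
        { guard := fun _ σ => ¬ ((own σ).l2Color = true ↔ isBlue σ)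
          statement := fun _ σ => { own σ with l2Color := decide (isBlue σ) } } ]
    (FirstOutcome C v q
      [ { guard := fun _ σ => (wrongL3ArcDest σ).Nonempty
          statement := fun _ σ =>
            { own σ with
              l3Arc := fun u =>
                if u ∈ wrongL3ArcDest σ then decide (hasL3Arc σ u) else (own σ).l3Arc u } } ]
    (FirstOutcome C v q
      [ { guard := fun _ σ => (wrongArcDest σ).Nonempty
          statement := fun _ σ =>
            { own σ with
              arc := fun u => if u ∈ wrongArcDest σ then false else (own σ).arc u } },
        { guard := fun _ σ => ¬ ((own σ).l4Branch = true ↔ isBranch σ)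
          statement := fun _ σ => { own σ with l4Branch := decide (isBranch σ) } },
        { guard := fun _ σ => (missingArcDest σ).Nonempty
          statement := fun _ σ =>
            { own σ with
              arc := fun u => if u ∈ missingArcDest σ then true else (own σ).arc u } },
        { guard := fun _ σ => (redundantArcDest σ).Nonempty
          statement := fun _ σ =>
            { own σ with
              arc := fun u => if u ∈ redundantArcDest σ then false else (own σ).arc u } } ]
      (q = C v)))) := by
  apply FirstOutcome.of_prioritize
  rcases h.compose with ⟨he, h⟩ | ⟨he, h4⟩
  · rcases h.compose with ⟨he', h⟩ | ⟨he', h3⟩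
    · rcases h.compose with ⟨he1, h1⟩ | ⟨he1, h2⟩
      · exact Or.inl ⟨he1, h1⟩
      · exact Or.inr ⟨he1, .of_prioritize
          (Or.inl ⟨(enabled_compose.1 he').resolve_left he1, h2⟩)⟩
    · have hn := not_or.1 (mt enabled_compose.2 he')
      exact Or.inr ⟨hn.1, .of_prioritize (Or.inr ⟨hn.2, .of_prioritize
        (Or.inl ⟨(enabled_compose.1 he).resolve_left he', h3⟩)⟩)⟩
  · have hn := not_or.1 (mt enabled_compose.2 he)
    have hn' := not_or.1 (mt enabled_compose.2 hn.1)
    refine Or.inr ⟨hn'.1, .of_prioritize (Or.inr ⟨hn'.2, .of_prioritize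
      (Or.inr ⟨hn.2, .of_prioritize ?_⟩)⟩)⟩
    by_cases he4 : Enabled (l4RedundantArcRemoval N) C v
    · exact Or.inl ⟨he4, h4⟩
    · refine Or.inr ⟨he4, ?_⟩
      rcases h4 with ⟨a, ha, hg, -⟩ | h4
      · exact absurd ⟨a, ha, hg⟩ he4
      · exact h4.2

open Classical in
/-- The possible actions of a node, by priority. -/
theorem Outcome.cases (h : Outcome (mwstdag N) C v q) {P : Prop}
    (layer1Dist : q = { C v with l1Dist := l1CorrectDist (view N.graph C v) } →
      (C v).l1Dist ≠ l1CorrectDist (view N.graph C v) → P)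
    (layer1Parent : q = { C v with l1Parent := l1CorrectParent (view N.graph C v) } →
      (C v).l1Dist = l1CorrectDist (view N.graph C v) →
      (C v).l1Parent ≠ l1CorrectParent (view N.graph C v) → P)
    (layer1Color : q = { C v with l1Color := decide (isRed (view N.graph C v)) } →
      (C v).l1Dist = l1CorrectDist (view N.graph C v) →
      (C v).l1Parent = l1CorrectParent (view N.graph C v) →
      ¬ ((C v).l1Color = true ↔ isRed (view N.graph C v)) → P)
    (layer2Dist : q = { C v with l2Dist := l2CorrectDist (view N.graph C v) } →
      Layer1Correct (view N.graph C v) →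
      (C v).l2Dist ≠ l2CorrectDist (view N.graph C v) → P)
    (layer2Parent : q = { C v with l2Parent := l2CorrectParent (view N.graph C v) } →
      Layer1Correct (view N.graph C v) →
      (C v).l2Dist = l2CorrectDist (view N.graph C v) →
      (C v).l2Parent ≠ l2CorrectParent (view N.graph C v) → P)
    (layer2Color : q = { C v with l2Color := decide (isBlue (view N.graph C v)) } →
      Layer1Correct (view N.graph C v) →
      (C v).l2Dist = l2CorrectDist (view N.graph C v) →
      (C v).l2Parent = l2CorrectParent (view N.graph C v) →
      ¬ ((C v).l2Color = true ↔ isBlue (view N.graph C v)) → P)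
    (layer3 : q = { C v with l3Arc := fun u => decide (hasL3Arc (view N.graph C v) u) } →
      Layer1Correct (view N.graph C v) → Layer2Correct (view N.graph C v) →
      ¬ (∀ u, (C v).l3Arc u = true ↔ hasL3Arc (view N.graph C v) u) → P)
    (layer4Wrong : q = { C v with arc := fun u => (C v).arc u && (C v).l3Arc u } →
      Layer3Correct (view N.graph C v) →
      ¬ (∀ u, (C v).arc u = true → (C v).l3Arc u = true) → P)
    (layer4Branch : q = { C v with l4Branch := decide (isBranch (view N.graph C v)) } →
      Layer3Correct (view N.graph C v) →
      (∀ u, (C v).arc u = true → (C v).l3Arc u = true) →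
      ¬ ((C v).l4Branch = true ↔ isBranch (view N.graph C v)) → P)
    (layer4Missing : q = { C v with arc := fun u => (C v).arc u ||
        ((C v).l3Arc u && !(decide (isRedundant (view N.graph C v) u))) } →
      Layer3Correct (view N.graph C v) →
      (∀ u, (C v).arc u = true → (C v).l3Arc u = true) →
      ((C v).l4Branch = true ↔ isBranch (view N.graph C v)) →
      ¬ (∀ u, ¬ isRedundant (view N.graph C v) u → (C v).l3Arc u = true →
        (C v).arc u = true) → P)
    (layer4Redundant : q = { C v with arc := fun u => (C v).arc u &&
        !(decide (isRedundant (view N.graph C v) u)) } →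
      Layer3Correct (view N.graph C v) →
      (∀ u, (C v).arc u = true → (C v).l3Arc u = true) →
      ((C v).l4Branch = true ↔ isBranch (view N.graph C v)) →
      (∀ u, ¬ isRedundant (view N.graph C v) u → (C v).l3Arc u = true →
        (C v).arc u = true) → P)
    (idle : q = C v →
      Layer3Correct (view N.graph C v) →
      (∀ u, (C v).arc u = true → (C v).l3Arc u = true) →
      ((C v).l4Branch = true ↔ isBranch (view N.graph C v)) →
      (∀ u, ¬ isRedundant (view N.graph C v) u → (C v).l3Arc u = true →
        (C v).arc u = true) →
      (∀ u, (C v).arc u = true → ¬ isRedundant (view N.graph C v) u) → P) : P := by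
  have hown : own (view N.graph C v) = C v := rfl
  have h := h.firstOutcome
  simp only [FirstOutcome, hown] at h
  rcases h with ⟨hg, hq⟩ | ⟨h1, h⟩
  · exact layer1Dist hq hg
  rw [not_not] at h1
  rcases h with ⟨hg, hq⟩ | ⟨h2, h⟩
  · exact layer1Parent hq h1 hg
  rw [not_not] at h2
  rcases h with ⟨hg, hq⟩ | ⟨h3, h⟩
  · exact layer1Color hq h1 h2 hg
  rw [not_not] at h3
  have L1 : Layer1Correct (view N.graph C v) := ⟨h1, h2, h3⟩
  rcases h with ⟨hg, hq⟩ | ⟨h4, h⟩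
  · exact layer2Dist hq L1 hg
  rw [not_not] at h4
  rcases h with ⟨hg, hq⟩ | ⟨h5, h⟩
  · exact layer2Parent hq L1 h4 hg
  rw [not_not] at h5
  rcases h with ⟨hg, hq⟩ | ⟨h6, h⟩
  · exact layer2Color hq L1 h4 h5 hg
  rw [not_not] at h6
  have L2 : Layer2Correct (view N.graph C v) := ⟨h4, h5, h6⟩
  rcases h with ⟨⟨u, hg⟩, hq⟩ | ⟨h7, h⟩
  · refine layer3 (hq.trans ?_) L1 L2 fun h => hg (h u)
    congr 1
    funext w
    by_cases hw : w ∈ wrongL3ArcDest (view N.graph C v)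
    · rw [if_pos hw]
    · rw [if_neg hw, Bool.eq_iff_iff, decide_eq_true_iff]
      exact not_not.1 hw
  have L3 : Layer3Correct (view N.graph C v) :=
    ⟨L1, L2, fun u => by_contra fun hu => h7 ⟨u, hu⟩⟩
  rcases h with ⟨⟨u, hg⟩, hq⟩ | ⟨h8, h⟩
  · refine layer4Wrong (hq.trans ?_) L3 fun h => by
      have := h u hg.2
      rw [show (C v).l3Arc u = false from hg.1] at this
      exact absurd this (by simp)
    congr 1
    funext w
    by_cases hw : w ∈ wrongArcDest (view N.graph C v)
    · have : (C v).l3Arc w = false := hw.1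
      rw [if_pos hw, this, Bool.and_false]
    · rw [if_neg hw]
      have : ¬ ((C v).l3Arc w = false ∧ (C v).arc w = true) := hw
      revert this
      cases (C v).l3Arc w <;> cases (C v).arc w <;> simp
  have h8' : ∀ u, (C v).arc u = true → (C v).l3Arc u = true := fun u hu =>
    by_contra fun hn => h8 ⟨u, Bool.eq_false_iff.2 hn, hu⟩
  rcases h with ⟨hg, hq⟩ | ⟨h9, h⟩
  · exact layer4Branch hq L3 h8' hg
  rw [not_not] at h9
  rcases h with ⟨⟨u, hg⟩, hq⟩ | ⟨h10, h⟩
  · refine layer4Missing (hq.trans ?_) L3 h8' h9 fun h => by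
      have := h u hg.1 hg.2.2
      rw [show (C v).arc u = false from hg.2.1] at this
      exact absurd this (by simp)
    congr 1
    funext w
    by_cases hw : w ∈ missingArcDest (view N.graph C v)
    · have h1 : (C v).l3Arc w = true := hw.2.2
      have h2 := hw.1
      rw [if_pos hw]
      simp [h1, h2]
    · rw [if_neg hw]
      have : ¬ (¬ isRedundant (view N.graph C v) w ∧ (C v).arc w = false ∧
        (C v).l3Arc w = true) := hw
      revert this
      cases (C v).l3Arc w <;> cases (C v).arc w <;> simp
  have h10' : ∀ u, ¬ isRedundant (view N.graph C v) u → (C v).l3Arc u = true →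
      (C v).arc u = true := fun u h1 h2 =>
    by_contra fun hn => h10 ⟨u, h1, Bool.eq_false_iff.2 hn, h2⟩
  rcases h with ⟨-, hq⟩ | ⟨h11, hq⟩
  · refine layer4Redundant (hq.trans ?_) L3 h8' h9 h10'
    congr 1
    funext w
    by_cases hw : w ∈ redundantArcDest (view N.graph C v)
    · have h2 := hw.1
      rw [if_pos hw]
      simp [h2]
    · rw [if_neg hw]
      have : ¬ (isRedundant (view N.graph C v) w ∧ (C v).arc w = true) := hw
      revert this
      cases (C v).arc w <;> simp
  · exact idle hq L3 h8' h9 h10' fun u h1 h2 => h11 ⟨u, h2, h1⟩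

variable (h : Outcome (mwstdag N) C v q)
include h

/-- This variable has top priority: either it is corrected now or it was already correct and is
untouched. Each later variable obeys the same principle, provided that everything of higher priority
was correct before the move. -/
theorem Outcome.l1Dist : q.l1Dist = l1CorrectDist (view N.graph C v) := by
  apply h.cases
  case layer1Dist => rintro rfl -; rfl
  case layer1Parent => rintro rfl h _; exact h
  case layer1Color => rintro rfl h _ _; exact h
  case layer2Dist => rintro rfl h _; exact h.dist
  case layer2Parent => rintro rfl h _ _; exact h.dist
  case layer2Color => rintro rfl h _ _ _; exact h.dist
  case layer3 => rintro rfl h _ _; exact h.dist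
  case layer4Wrong => rintro rfl h _; exact h.layer1.dist
  case layer4Branch => rintro rfl h _ _; exact h.layer1.dist
  case layer4Missing => rintro rfl h _ _ _; exact h.layer1.dist
  case layer4Redundant => rintro rfl h _ _ _; exact h.layer1.dist
  case idle => rintro rfl h _ _ _ _; exact h.layer1.dist

theorem Outcome.l1Parent (h1 : (C v).l1Dist = l1CorrectDist (view N.graph C v)) :
    q.l1Parent = l1CorrectParent (view N.graph C v) := by
  apply h.cases
  case layer1Dist => intro _ h; exact absurd h1 h
  case layer1Parent => rintro rfl _ _; rfl
  case layer1Color => rintro rfl _ h _; exact h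
  case layer2Dist => rintro rfl h _; exact h.parent
  case layer2Parent => rintro rfl h _ _; exact h.parent
  case layer2Color => rintro rfl h _ _ _; exact h.parent
  case layer3 => rintro rfl h _ _; exact h.parent
  case layer4Wrong => rintro rfl h _; exact h.layer1.parent
  case layer4Branch => rintro rfl h _ _; exact h.layer1.parent
  case layer4Missing => rintro rfl h _ _ _; exact h.layer1.parent
  case layer4Redundant => rintro rfl h _ _ _; exact h.layer1.parent
  case idle => rintro rfl h _ _ _ _; exact h.layer1.parent

theorem Outcome.l1Color (h1 : (C v).l1Dist = l1CorrectDist (view N.graph C v))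
    (h2 : (C v).l1Parent = l1CorrectParent (view N.graph C v)) :
    q.l1Color = true ↔ isRed (view N.graph C v) := by
  apply h.cases
  case layer1Dist => intro _ h; exact absurd h1 h
  case layer1Parent => intro _ _ h; exact absurd h2 h
  case layer1Color => rintro rfl _ _ _; simp
  case layer2Dist => rintro rfl h _; exact h.color
  case layer2Parent => rintro rfl h _ _; exact h.color
  case layer2Color => rintro rfl h _ _ _; exact h.color
  case layer3 => rintro rfl h _ _; exact h.color
  case layer4Wrong => rintro rfl h _; exact h.layer1.color
  case layer4Branch => rintro rfl h _ _; exact h.layer1.color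
  case layer4Missing => rintro rfl h _ _ _; exact h.layer1.color
  case layer4Redundant => rintro rfl h _ _ _; exact h.layer1.color
  case idle => rintro rfl h _ _ _ _; exact h.layer1.color

/-- Needs no correctness assumption, so it applies from arbitrary configurations; the memory bound
uses it. -/
theorem Outcome.l2Dist_or : q.l2Dist = (C v).l2Dist ∨
    (Layer1Correct (view N.graph C v) ∧ q.l2Dist = l2CorrectDist (view N.graph C v)) := by
  apply h.cases
  case layer2Dist => rintro rfl h _; exact Or.inr ⟨h, rfl⟩
  all_goals rintro rfl; intros; exact Or.inl rfl

variable (L1 : Layer1Correct (view N.graph C v))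
include L1

theorem Outcome.l2Dist : q.l2Dist = l2CorrectDist (view N.graph C v) := by
  apply h.cases
  case layer1Dist => intro _ h; exact absurd L1.dist h
  case layer1Parent => intro _ _ h; exact absurd L1.parent h
  case layer1Color => intro _ _ _ h; exact absurd L1.color h
  case layer2Dist => rintro rfl _ _; rfl
  case layer2Parent => rintro rfl _ h _; exact h
  case layer2Color => rintro rfl _ h _ _; exact h
  case layer3 => rintro rfl _ h _; exact h.dist
  case layer4Wrong => rintro rfl h _; exact h.layer2.dist
  case layer4Branch => rintro rfl h _ _; exact h.layer2.dist
  case layer4Missing => rintro rfl h _ _ _; exact h.layer2.dist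
  case layer4Redundant => rintro rfl h _ _ _; exact h.layer2.dist
  case idle => rintro rfl h _ _ _ _; exact h.layer2.dist

theorem Outcome.l2Parent (h1 : (C v).l2Dist = l2CorrectDist (view N.graph C v)) :
    q.l2Parent = l2CorrectParent (view N.graph C v) := by
  apply h.cases
  case layer1Dist => intro _ h; exact absurd L1.dist h
  case layer1Parent => intro _ _ h; exact absurd L1.parent h
  case layer1Color => intro _ _ _ h; exact absurd L1.color h
  case layer2Dist => intro _ _ h; exact absurd h1 h
  case layer2Parent => rintro rfl _ _ _; rfl
  case layer2Color => rintro rfl _ _ h _; exact h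
  case layer3 => rintro rfl _ h _; exact h.parent
  case layer4Wrong => rintro rfl h _; exact h.layer2.parent
  case layer4Branch => rintro rfl h _ _; exact h.layer2.parent
  case layer4Missing => rintro rfl h _ _ _; exact h.layer2.parent
  case layer4Redundant => rintro rfl h _ _ _; exact h.layer2.parent
  case idle => rintro rfl h _ _ _ _; exact h.layer2.parent

theorem Outcome.l2Color (h1 : (C v).l2Dist = l2CorrectDist (view N.graph C v))
    (h2 : (C v).l2Parent = l2CorrectParent (view N.graph C v)) :
    q.l2Color = true ↔ isBlue (view N.graph C v) := by
  apply h.cases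
  case layer1Dist => intro _ h; exact absurd L1.dist h
  case layer1Parent => intro _ _ h; exact absurd L1.parent h
  case layer1Color => intro _ _ _ h; exact absurd L1.color h
  case layer2Dist => intro _ _ h; exact absurd h1 h
  case layer2Parent => intro _ _ _ h; exact absurd h2 h
  case layer2Color => rintro rfl _ _ _ _; simp
  case layer3 => rintro rfl _ h _; exact h.color
  case layer4Wrong => rintro rfl h _; exact h.layer2.color
  case layer4Branch => rintro rfl h _ _; exact h.layer2.color
  case layer4Missing => rintro rfl h _ _ _; exact h.layer2.color
  case layer4Redundant => rintro rfl h _ _ _; exact h.layer2.color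
  case idle => rintro rfl h _ _ _ _; exact h.layer2.color

theorem Outcome.l3Arc (L2 : Layer2Correct (view N.graph C v)) (u : Nbr N.graph v) :
    q.l3Arc u = true ↔ hasL3Arc (view N.graph C v) u := by
  apply h.cases
  case layer1Dist => intro _ h; exact absurd L1.dist h
  case layer1Parent => intro _ _ h; exact absurd L1.parent h
  case layer1Color => intro _ _ _ h; exact absurd L1.color h
  case layer2Dist => intro _ _ h; exact absurd L2.dist h
  case layer2Parent => intro _ _ _ h; exact absurd L2.parent h
  case layer2Color => intro _ _ _ _ h; exact absurd L2.color h
  case layer3 => rintro rfl _ _ _; simp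
  case layer4Wrong => rintro rfl h _; exact h.arc u
  case layer4Branch => rintro rfl h _ _; exact h.arc u
  case layer4Missing => rintro rfl h _ _ _; exact h.arc u
  case layer4Redundant => rintro rfl h _ _ _; exact h.arc u
  case idle => rintro rfl h _ _ _ _; exact h.arc u

omit L1
variable (L3 : Layer3Correct (view N.graph C v))
include L3

theorem Outcome.arc_le (u : Nbr N.graph v) : q.arc u = true → q.l3Arc u = true := by
  apply h.cases
  case layer1Dist => intro _ h; exact absurd L3.layer1.dist h
  case layer1Parent => intro _ _ h; exact absurd L3.layer1.parent h
  case layer1Color => intro _ _ _ h; exact absurd L3.layer1.color h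
  case layer2Dist => intro _ _ h; exact absurd L3.layer2.dist h
  case layer2Parent => intro _ _ _ h; exact absurd L3.layer2.parent h
  case layer2Color => intro _ _ _ _ h; exact absurd L3.layer2.color h
  case layer3 => intro _ _ _ h; exact absurd L3.arc h
  case layer4Wrong => rintro rfl _ _; simp
  case layer4Branch => rintro rfl _ h _; exact h u
  case layer4Missing => rintro rfl _ h _ _; simpa using fun h1 => h1.elim (h u) And.left
  case layer4Redundant => rintro rfl _ h _ _; simpa using fun h1 _ => h u h1
  case idle => rintro rfl _ h _ _ _; exact h u

variable (h4 : ∀ u, (C v).arc u = true → (C v).l3Arc u = true)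
include h4

theorem Outcome.l4Branch : q.l4Branch = true ↔ isBranch (view N.graph C v) := by
  apply h.cases
  case layer1Dist => intro _ h; exact absurd L3.layer1.dist h
  case layer1Parent => intro _ _ h; exact absurd L3.layer1.parent h
  case layer1Color => intro _ _ _ h; exact absurd L3.layer1.color h
  case layer2Dist => intro _ _ h; exact absurd L3.layer2.dist h
  case layer2Parent => intro _ _ _ h; exact absurd L3.layer2.parent h
  case layer2Color => intro _ _ _ _ h; exact absurd L3.layer2.color h
  case layer3 => intro _ _ _ h; exact absurd L3.arc h
  case layer4Wrong => intro _ _ h; exact absurd h4 h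
  case layer4Branch => rintro rfl _ _ _; simp
  case layer4Missing => rintro rfl _ _ h _; exact h
  case layer4Redundant => rintro rfl _ _ h _; exact h
  case idle => rintro rfl _ _ h _ _; exact h

variable (hb : (C v).l4Branch = true ↔ isBranch (view N.graph C v))
include hb

/-- Insertion of missing arcs precedes removal of redundant ones, so needed arcs are present after
one move, while exactness (`Outcome.arc`) needs them present beforehand. -/
theorem Outcome.le_arc (u : Nbr N.graph v) (h1 : (C v).l3Arc u = true)
    (h2 : ¬ isRedundant (view N.graph C v) u) : q.arc u = true := by
  apply h.cases
  case layer1Dist => intro _ h; exact absurd L3.layer1.dist h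
  case layer1Parent => intro _ _ h; exact absurd L3.layer1.parent h
  case layer1Color => intro _ _ _ h; exact absurd L3.layer1.color h
  case layer2Dist => intro _ _ h; exact absurd L3.layer2.dist h
  case layer2Parent => intro _ _ _ h; exact absurd L3.layer2.parent h
  case layer2Color => intro _ _ _ _ h; exact absurd L3.layer2.color h
  case layer3 => intro _ _ _ h; exact absurd L3.arc h
  case layer4Wrong => intro _ _ h; exact absurd h4 h
  case layer4Branch => intro _ _ _ h; exact absurd hb h
  case layer4Missing => rintro rfl _ _ _ _; simp [h1, h2]
  case layer4Redundant => rintro rfl _ _ _ h; simp [h u h2 h1, h2]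
  case idle => rintro rfl _ _ _ h _; exact h u h2 h1

theorem Outcome.arc (hm : ∀ u, ¬ isRedundant (view N.graph C v) u → (C v).l3Arc u = true →
      (C v).arc u = true) (u : Nbr N.graph v) :
    q.arc u = true ↔ (C v).l3Arc u = true ∧ ¬ isRedundant (view N.graph C v) u := by
  apply h.cases
  case layer1Dist => intro _ h; exact absurd L3.layer1.dist h
  case layer1Parent => intro _ _ h; exact absurd L3.layer1.parent h
  case layer1Color => intro _ _ _ h; exact absurd L3.layer1.color h
  case layer2Dist => intro _ _ h; exact absurd L3.layer2.dist h
  case layer2Parent => intro _ _ _ h; exact absurd L3.layer2.parent h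
  case layer2Color => intro _ _ _ _ h; exact absurd L3.layer2.color h
  case layer3 => intro _ _ _ h; exact absurd L3.arc h
  case layer4Wrong => intro _ _ h; exact absurd h4 h
  case layer4Branch => intro _ _ _ h; exact absurd hb h
  case layer4Missing => intro _ _ _ _ h; exact absurd hm h
  case layer4Redundant =>
    rintro rfl _ _ _ _
    simp only [Bool.and_eq_true, Bool.not_eq_true', decide_eq_false_iff_not]
    exact ⟨fun h => ⟨h4 u h.1, h.2⟩, fun h => ⟨hm u h.2 h.1, h.2⟩⟩
  case idle =>
    rintro rfl _ _ _ _ h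
    exact ⟨fun h1 => ⟨h4 u h1, h u h1⟩, fun h1 => hm u h1.2 h1.1⟩

end Actions

/-! ### Convergence of the four layers -/

section Convergence

variable {V : Type*} {N : Network V}

/-! ### Distances and parents -/

theorem iInf_min_eq {ι : Type*} [Nonempty ι] {f g : ι → ℕ} {k : ℕ}
    (h : ∀ i, min (f i) k = min (g i) k) : min (⨅ i, f i) k = min (⨅ i, g i) k := by
  obtain ⟨i, hi⟩ := Set.mem_range.1 (Nat.sInf_mem (Set.range_nonempty f))
  obtain ⟨j, hj⟩ := Set.mem_range.1 (Nat.sInf_mem (Set.range_nonempty g))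
  change f i = ⨅ i, f i at hi
  change g j = ⨅ i, g i at hj
  have h1 : (⨅ i, f i) ≤ f j := ciInf_le' f j
  have h2 : (⨅ i, g i) ≤ g i := ciInf_le' g i
  have h3 := h i
  have h4 := h j
  omega

open Classical in
/-- A distance variable that is always set by the rule of shortest paths converges. -/
theorem Attains.dist [Finite V] {A : Algorithm N.graph (NodeState N)} {r : ℕ}
    {P : Config (NodeState N) → Prop} (h : Attains A r P) {X : Set V} (hX : X.Nonempty)
    (d : ∀ v, NodeState N v → ℕ)
    (hd : ∀ C, P C → ∀ v q, Outcome A C v q →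
      d v q = if v ∈ X then 0 else (⨅ u : Nbr N.graph v, d u.1 (C u.1)) + 1) :
    Attains A (r + (N.diam + 1)) fun C => P C ∧ ∀ v, d v (C v) = distTo N X v := by
  -- After `k` rounds all distances below `k` are exact and all other variables are at least `k`.
  -- Truncation at `k` treats too small and too large initial values alike; `k = D + 1` exceeds
  -- every true distance.
  refine (h.iterate (fun k v q => min (d v q) k = min (distTo N X v) k) (by simp) ?_
    (N.diam + 1)).mono fun C hC => ⟨hC.1, fun v => ?_⟩
  · intro k C hC hk v q hq
    rw [hd C hC v q hq]
    split_ifs with hv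
    · rw [distTo_eq_zero hv]
    · have := N.nonempty_nbr v
      rw [← iInf_distTo hX hv]
      have := iInf_min_eq fun u : Nbr N.graph v => hk u.1
      omega
  · have h1 := hC.2 v
    have h2 := distTo_le_diam (N := N) hX v
    omega

/-- The variables of layer 1 have their final values. -/
structure Layer1Stable (C : Config (NodeState N)) : Prop where
  dist : ∀ v, (C v).l1Dist = distTo N N.senders v
  parent : ∀ v, (C v).l1Parent = bfsParent N N.senders v
  color : ∀ v, (C v).l1Color = true ↔ Red N v

/-- The variables of layer 2 have their final values. -/
structure Layer2Stable (C : Config (NodeState N)) : Prop where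
  dist : ∀ v, (C v).l2Dist = distTo N {v | Red N v} v
  parent : ∀ v, (C v).l2Parent = bfsParent N {v | Red N v} v
  color : ∀ v, (C v).l2Color = true ↔ Blue N v

/-- The variables of the first three layers have their final values. -/
structure Layer3Stable (C : Config (NodeState N)) : Prop where
  layer1 : Layer1Stable C
  layer2 : Layer2Stable C
  arc : ∀ v u, (C v).l3Arc u = true ↔ WeakArc N v u.1

/-- All variables but the arcs of layer 4 have their final values. -/
structure BranchStable (C : Config (NodeState N)) : Prop where
  layer3 : Layer3Stable C
  arc_le : ∀ v u, (C v).arc u = true → (C v).l3Arc u = true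
  branch : ∀ v, (C v).l4Branch = true ↔ Branch N v

/-- All variables have their final values. -/
structure Stable (C : Config (NodeState N)) : Prop where
  branchStable : BranchStable C
  arc : ∀ v u, (C v).arc u = true ↔ FinalArc N v u.1

variable {C : Config (NodeState N)} {v : V}

/-! ### Layer 1 -/

theorem l1CorrectDist_eq (h : ∀ v, (C v).l1Dist = distTo N N.senders v) :
    l1CorrectDist (view N.graph C v) = distTo N N.senders v := by
  rw [l1CorrectDist]
  split_ifs with hv
  · rw [distTo_eq_zero hv]
  · rw [← iInf_distTo N.senders_nonempty hv]
    congr 1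
    exact iInf_congr fun u => h u.1

theorem l1CorrectParent_eq (h : ∀ v, (C v).l1Dist = distTo N N.senders v) :
    l1CorrectParent (view N.graph C v) = bfsParent N N.senders v := by
  rw [l1CorrectParent, bfsParent, nearestL1Parent]
  simp only [nbr, view, h]

/-- The colour of `u` is assumed correct only if `u` is a tree child of `v`, which is all that the
level induction provides. -/
theorem mem_redChild_iff (hp : ∀ v, (C v).l1Parent = bfsParent N N.senders v)
    {u : Nbr N.graph v} (hc : senderParent N u.1 = v → ((C u.1).l1Color = true ↔ Red N u.1)) :
    u ∈ redChild (view N.graph C v) ↔ RedChild N v u.1 := by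
  change (C u.1).l1Parent.1 = v ∧ (C u.1).l1Color = true ↔ _
  rw [hp]
  exact ⟨fun h => ⟨u.2, h.1, (hc h.1).1 h.2⟩, fun h => ⟨h.2.1, (hc h.2.1).2 h.2.2⟩⟩

theorem isRed_iff (hp : ∀ v, (C v).l1Parent = bfsParent N N.senders v)
    (hc : ∀ u : Nbr N.graph v, senderParent N u.1 = v →
      ((C u.1).l1Color = true ↔ Red N u.1)) :
    isRed (view N.graph C v) ↔ Red N v := by
  rw [red_iff, isRed]
  refine or_congr_right ⟨fun ⟨u, hu⟩ => ⟨u.1, (mem_redChild_iff hp (hc u)).1 hu⟩,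
    fun ⟨u, hu⟩ => ⟨⟨u, hu.1⟩, (mem_redChild_iff hp (hc ⟨u, hu.1⟩)).2 hu⟩⟩

/-- Colours and branch marks propagate from the leaves to the roots, so levels count depth from the
bottom and children have smaller level. -/
theorem distTo_lt_of_parent [Finite V] {X : Set V} (hX : X.Nonempty) {u : Nbr N.graph v}
    (hu : (bfsParent N X u.1).1 = v) : N.diam - distTo N X u.1 < N.diam - distTo N X v := by
  have h1 := distTo_of_child hX u.2 hu
  have h2 := distTo_le_diam (N := N) hX u.1
  omega

theorem attains_layer1Stable [Finite V] :
    Attains (mwstdag N) (2 * N.diam + 3) (Layer1Stable (N := N)) := by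
  have h1 := Attains.dist (attains_zero (A := mwstdag N)) N.senders_nonempty (fun _ q => q.l1Dist)
    fun _ _ _ _ hq => hq.l1Dist
  have h2 := h1.succ (fun v q => q.l1Parent = bfsParent N N.senders v) fun C hC v q hq => by
    rw [← l1CorrectParent_eq hC.2]
    exact hq.l1Parent ((hC.2 v).trans (l1CorrectDist_eq hC.2).symm)
  have h3 := h2.levels (fun v => N.diam - distTo N N.senders v) N.diam (fun v => Nat.sub_le _ _)
    (fun v q => q.l1Color = true ↔ Red N v) fun C hC v q hq hu => by
      rw [← isRed_iff hC.2 fun u hp => hu u.1 (distTo_lt_of_parent N.senders_nonempty hp)]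
      exact hq.l1Color ((hC.1.2 v).trans (l1CorrectDist_eq hC.1.2).symm)
        ((hC.2 v).trans (l1CorrectParent_eq hC.1.2).symm)
  rw [show 2 * N.diam + 3 = 0 + (N.diam + 1) + 1 + (N.diam + 1) by ring]
  exact h3.mono fun C hC => ⟨hC.1.1.2, hC.1.2, hC.2⟩

theorem Layer1Stable.mem_redChild (h : Layer1Stable C) {u : Nbr N.graph v} :
    u ∈ redChild (view N.graph C v) ↔ RedChild N v u.1 :=
  mem_redChild_iff h.parent fun _ => h.color u.1

theorem Layer1Stable.correct (h : Layer1Stable C) (v : V) :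
    Layer1Correct (view N.graph C v) where
  dist := (h.dist v).trans (l1CorrectDist_eq h.dist).symm
  parent := (h.parent v).trans (l1CorrectParent_eq h.dist).symm
  color := (h.color v).trans (isRed_iff h.parent fun u _ => h.color u.1).symm

/-! ### Layer 2 -/

theorem l2CorrectDist_eq (hc : Layer1Stable C)
    (h : ∀ v, (C v).l2Dist = distTo N {v | Red N v} v) :
    l2CorrectDist (view N.graph C v) = distTo N {v | Red N v} v := by
  rw [l2CorrectDist]
  split_ifs with hv
  · rw [distTo_eq_zero (X := {v | Red N v}) ((hc.color v).1 hv)]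
  · rw [← iInf_distTo (X := {v | Red N v}) red_nonempty (mt (hc.color v).2 hv)]
    congr 1
    exact iInf_congr fun u => h u.1

open Classical in
theorem l2CorrectParent_eq (hc : Layer1Stable C)
    (h : ∀ v, (C v).l2Dist = distTo N {v | Red N v} v) :
    l2CorrectParent (view N.graph C v) = bfsParent N {v | Red N v} v := by
  rw [l2CorrectParent, bfsParent, nearestL2Parent]
  simp only [nbr, view, h]
  exact if_congr (hc.color v) rfl rfl

theorem mem_blueChild_iff (hp : ∀ v, (C v).l2Parent = bfsParent N {v | Red N v} v)
    {u : Nbr N.graph v} (hc : redParent N u.1 = v → ((C u.1).l2Color = true ↔ Blue N u.1)) :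
    u ∈ blueChild (view N.graph C v) ↔ BlueChild N v u.1 := by
  change (C u.1).l2Parent.1 = v ∧ (C u.1).l2Color = true ↔ _
  rw [hp]
  exact ⟨fun h => ⟨u.2, h.1, (hc h.1).1 h.2⟩, fun h => ⟨h.2.1, (hc h.2.1).2 h.2.2⟩⟩

theorem isBlue_iff (h1 : Layer1Stable C) (hp : ∀ v, (C v).l2Parent = bfsParent N {v | Red N v} v)
    (hc : ∀ u : Nbr N.graph v, redParent N u.1 = v →
      ((C u.1).l2Color = true ↔ Blue N u.1)) :
    isBlue (view N.graph C v) ↔ Blue N v := by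
  rw [blue_iff, isBlue, ← h1.color, Bool.not_eq_true]
  refine and_congr_right' (or_congr_right ⟨fun ⟨u, hu⟩ => ⟨u.1, (mem_blueChild_iff hp (hc u)).1 hu⟩,
    fun ⟨u, hu⟩ => ⟨⟨u, hu.1⟩, (mem_blueChild_iff hp (hc ⟨u, hu.1⟩)).2 hu⟩⟩)

open Classical in
theorem attains_layer2Stable [Finite V] :
    Attains (mwstdag N) (4 * N.diam + 6)
      fun C : Config (NodeState N) => Layer1Stable C ∧ Layer2Stable C := by
  have h1 := Attains.dist (attains_layer1Stable (N := N)) (red_nonempty (N := N))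
    (fun _ q => q.l2Dist) fun C hC v q hq => by
      rw [hq.l2Dist (hC.correct v), l2CorrectDist]
      exact if_congr (hC.color v) rfl rfl
  have h2 := h1.succ (fun v q => q.l2Parent = bfsParent N {v | Red N v} v) fun C hC v q hq => by
    rw [← l2CorrectParent_eq hC.1 hC.2]
    exact hq.l2Parent (hC.1.correct v) ((hC.2 v).trans (l2CorrectDist_eq hC.1 hC.2).symm)
  have h3 := h2.levels (fun v => N.diam - distTo N {v | Red N v} v) N.diam
    (fun v => Nat.sub_le _ _) (fun v q => q.l2Color = true ↔ Blue N v) fun C hC v q hq hu => by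
      rw [← isBlue_iff hC.1.1 hC.2 fun u hp => hu u.1 (distTo_lt_of_parent red_nonempty hp)]
      exact hq.l2Color (hC.1.1.correct v)
        ((hC.1.2 v).trans (l2CorrectDist_eq hC.1.1 hC.1.2).symm)
        ((hC.2 v).trans (l2CorrectParent_eq hC.1.1 hC.1.2).symm)
  rw [show 4 * N.diam + 6 = 2 * N.diam + 3 + (N.diam + 1) + 1 + (N.diam + 1) by ring]
  exact h3.mono fun C hC => ⟨hC.1.1.1, hC.1.1.2, hC.1.2, hC.2⟩

theorem Layer2Stable.mem_blueChild (h : Layer2Stable C) {u : Nbr N.graph v} :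
    u ∈ blueChild (view N.graph C v) ↔ BlueChild N v u.1 :=
  mem_blueChild_iff h.parent fun _ => h.color u.1

theorem Layer2Stable.blueChild_nonempty (h : Layer2Stable C) :
    (blueChild (view N.graph C v)).Nonempty ↔ ∃ u, BlueChild N v u :=
  ⟨fun ⟨u, hu⟩ => ⟨u.1, h.mem_blueChild.1 hu⟩, fun ⟨u, hu⟩ => ⟨⟨u, hu.1⟩, h.mem_blueChild.2 hu⟩⟩

theorem Layer2Stable.correct (h : Layer2Stable C) (h1 : Layer1Stable C) (v : V) :
    Layer2Correct (view N.graph C v) where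
  dist := (h.dist v).trans (l2CorrectDist_eq h1 h.dist).symm
  parent := (h.parent v).trans (l2CorrectParent_eq h1 h.dist).symm
  color := (h.color v).trans (isBlue_iff h1 h.parent fun u _ => h.color u.1).symm

/-! ### Layer 3 -/

theorem hasL3Arc_iff (h1 : Layer1Stable C) (h2 : Layer2Stable C) (u : Nbr N.graph v) :
    hasL3Arc (view N.graph C v) u ↔ WeakArc N v u.1 := by
  rw [hasL3Arc, WeakArc, h1.mem_redChild]
  change ((C v).l1Color = true ∧ _) ∨ ((C v).l2Color = true ∧ (C v).l2Parent.1 = u.1) ↔ _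
  rw [h1.color, h2.color, h2.parent, redParent]

theorem attains_layer3Stable [Finite V] :
    Attains (mwstdag N) (4 * N.diam + 7) (Layer3Stable (N := N)) :=
  (attains_layer2Stable.succ (fun v q => ∀ u, q.l3Arc u = true ↔ WeakArc N v u.1)
    fun _ hC v _ hq u => (hq.l3Arc (hC.1.correct v) (hC.2.correct hC.1 v) u).trans
      (hasL3Arc_iff hC.1 hC.2 u)).mono fun _ hC => ⟨hC.1.1, hC.1.2, hC.2⟩

theorem Layer3Stable.correct (h : Layer3Stable C) (v : V) :
    Layer3Correct (view N.graph C v) where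
  layer1 := h.layer1.correct v
  layer2 := h.layer2.correct h.layer1 v
  arc u := (h.arc v u).trans (hasL3Arc_iff h.layer1 h.layer2 u).symm

/-! ### Layer 4 -/

theorem mem_branchChild_iff (h : Layer1Stable C) {u : Nbr N.graph v}
    (hb : senderParent N u.1 = v → ((C u.1).l4Branch = true ↔ Branch N u.1)) :
    u ∈ branchChild (view N.graph C v) ↔ senderParent N u.1 = v ∧ Branch N u.1 := by
  change (C u.1).l1Parent.1 = v ∧ (C u.1).l4Branch = true ↔ _
  rw [h.parent]
  exact and_congr_right hb

theorem branchChild_subset (h : Layer1Stable C)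
    (hb : ∀ u : Nbr N.graph v, senderParent N u.1 = v →
      ((C u.1).l4Branch = true ↔ Branch N u.1)) :
    branchChild (view N.graph C v) ⊆ redChild (view N.graph C v) := fun u hu => by
  have := (mem_branchChild_iff h (hb u)).1 hu
  exact h.mem_redChild.2 ⟨u.2, this.1, this.2.red⟩

theorem redChild_subset_branchChild_iff (h : Layer1Stable C)
    (hb : ∀ u : Nbr N.graph v, senderParent N u.1 = v →
      ((C u.1).l4Branch = true ↔ Branch N u.1)) :
    redChild (view N.graph C v) ⊆ branchChild (view N.graph C v) ↔
      ∀ w, RedChild N v w → Branch N w :=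
  ⟨fun hs w hw => ((mem_branchChild_iff h (hb ⟨w, hw.1⟩)).1 (hs (h.mem_redChild.2 hw))).2,
    fun hs u hu => (mem_branchChild_iff h (hb u)).2
      ⟨(h.mem_redChild.1 hu).2.1, hs _ (h.mem_redChild.1 hu)⟩⟩

theorem isBranch_iff (h : Layer3Stable C)
    (hb : ∀ u : Nbr N.graph v, senderParent N u.1 = v →
      ((C u.1).l4Branch = true ↔ Branch N u.1)) :
    isBranch (view N.graph C v) ↔ Branch N v := by
  have hR : (redChild (view N.graph C v)).Nonempty ↔ ∃ u, RedChild N v u :=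
    ⟨fun ⟨u, hu⟩ => ⟨u.1, h.layer1.mem_redChild.1 hu⟩,
      fun ⟨u, hu⟩ => ⟨⟨u, hu.1⟩, h.layer1.mem_redChild.2 hu⟩⟩
  have heq : branchChild (view N.graph C v) = redChild (view N.graph C v) ↔
      ∀ w, RedChild N v w → Branch N w := by
    rw [Set.Subset.antisymm_iff, redChild_subset_branchChild_iff h.layer1 hb,
      and_iff_right (branchChild_subset h.layer1 hb)]
  rw [branch_iff, isBranch, h.layer2.blueChild_nonempty, hR, heq]
  exact and_congr_left' (h.layer1.color v)

theorem attains_branchStable [Finite V] :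
    Attains (mwstdag N) (5 * N.diam + 9) (BranchStable (N := N)) := by
  have h1 := (attains_layer3Stable (N := N)).succ
    (fun v q => ∀ u, q.arc u = true → q.l3Arc u = true)
    fun _ hC v _ hq u => hq.arc_le (hC.correct v) u
  have h2 := h1.levels (fun v => N.diam - distTo N N.senders v) N.diam (fun v => Nat.sub_le _ _)
    (fun v q => q.l4Branch = true ↔ Branch N v) fun C hC v q hq hu => by
      rw [← isBranch_iff hC.1 fun u hp => hu u.1 (distTo_lt_of_parent N.senders_nonempty hp)]
      exact hq.l4Branch (hC.1.correct v) (hC.2 v)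
  rw [show 5 * N.diam + 9 = 4 * N.diam + 7 + 1 + (N.diam + 1) by ring]
  exact h2.mono fun C hC => ⟨hC.1.1, hC.1.2, hC.2⟩

theorem removalRules_iff (h : BranchStable C) (u : Nbr N.graph v) :
    removalRule1 (view N.graph C v) u ∨ removalRule2 (view N.graph C v) u ∨
      removalRule3 (view N.graph C v) u ↔ Droppable N v u.1 := by
  have hb : ∀ u : Nbr N.graph v, senderParent N u.1 = v →
      ((C u.1).l4Branch = true ↔ Branch N u.1) := fun u _ => h.branch u.1
  have hsub := branchChild_subset h.layer3.layer1 hb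
  have hmin : (minBranchChild (view N.graph C v)).1 = leastBranchChild N v := by
    rw [minBranchChild, leastBranchChild]
    congr 2
    ext u
    exact mem_branchChild_iff h.layer3.layer1 (hb u)
  have hss : branchChild (view N.graph C v) ⊂ redChild (view N.graph C v) ↔
      ∃ w, RedChild N v w ∧ ¬ Branch N w := by
    rw [Set.ssubset_def, redChild_subset_branchChild_iff h.layer3.layer1 hb]
    simp [hsub]
  have heq : branchChild (view N.graph C v) = redChild (view N.graph C v) ↔
      ¬ ∃ w, RedChild N v w ∧ ¬ Branch N w := by
    rw [Set.Subset.antisymm_iff, redChild_subset_branchChild_iff h.layer3.layer1 hb]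
    simp [hsub]
  rw [removalRule1, removalRule2, removalRule3, hss, heq, hmin,
    mem_branchChild_iff h.layer3.layer1 (hb u), Droppable]
  generalize (∃ w, RedChild N v w ∧ ¬ Branch N w) = p
  tauto

/-- The fourth rule is the only one that reads output arcs, and only those of the layer 1 parent;
this is why the arcs settle from the roots downwards. -/
theorem removalRule4_iff (h : Layer3Stable C)
    (hp : senderParent N v ≠ v → ∀ u, (C (senderParent N v)).arc u = true ↔
      FinalArc N (senderParent N v) u.1) :
    removalRule4 (view N.graph C v) ↔ ¬ Served N v := by
  have hq : (C v).l1Parent.1 = senderParent N v := by rw [h.layer1.parent]; rfl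
  change (C v).l1Parent.1 ≠ v ∧
    (∀ ha : N.graph.Adj (C v).l1Parent.1 v, (C (C v).l1Parent.1).arc ⟨v, ha⟩ = false) ∧ _ ↔ _
  rw [hq, Served, not_or, not_or, ← h.layer2.blueChild_nonempty, Set.not_nonempty_iff_eq_empty]
  refine and_congr_right fun hv => ?_
  rw [and_comm]
  refine and_congr_right' ⟨fun h1 h2 => ?_, fun h1 ha => ?_⟩
  · have ha := (finalArc_iff.1 h2).1.adj
    have := (hp hv ⟨v, ha⟩).2 h2
    rw [h1 ha] at this
    cases this
  · exact Bool.eq_false_iff.2 fun h2 => h1 ((hp hv ⟨v, ha⟩).1 h2)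

theorem finalArc_iff_not_isRedundant (h : BranchStable C)
    (hp : senderParent N v ≠ v → ∀ u, (C (senderParent N v)).arc u = true ↔
      FinalArc N (senderParent N v) u.1) (u : Nbr N.graph v) :
    (C v).l3Arc u = true ∧ ¬ isRedundant (view N.graph C v) u ↔ FinalArc N v u.1 := by
  rw [finalArc_iff, h.layer3.arc, isRedundant, ← or_assoc, ← or_assoc, or_assoc (a := removalRule1 _ _),
    removalRules_iff h, removalRule4_iff h.layer3 hp, not_or, not_not]

theorem BranchStable.isBranch_iff (h : BranchStable C) (v : V) :
    (C v).l4Branch = true ↔ isBranch (view N.graph C v) :=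
  (h.branch v).trans (MWST.isBranch_iff h.layer3 fun u _ => h.branch u.1).symm

theorem attains_stable [Finite V] :
    Attains (mwstdag N) (7 * N.diam + 11) (Stable (N := N)) := by
  have h1 := (attains_branchStable (N := N)).iterate
    -- Two rounds per depth: once the parent's arcs are exact, one round makes the needed arcs
    -- present and the next removes the redundant ones.
    (fun k v q =>
      (2 * distTo N N.senders v < k → ∀ u, FinalArc N v u.1 → q.arc u = true) ∧
      (2 * distTo N N.senders v + 1 < k → ∀ u, q.arc u = true ↔ FinalArc N v u.1))
    (by simp) (fun k C hC hk v q hq => by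
      have hp : 2 * distTo N N.senders v < k + 1 → senderParent N v ≠ v →
          ∀ u, (C (senderParent N v)).arc u = true ↔ FinalArc N (senderParent N v) u.1 := by
        intro hv hvs
        have := (bfsParent_of_notMem (N := N) N.senders_nonempty (mt senderParent_eq_self.2 hvs)).2
        change distTo N N.senders (senderParent N v) + 1 = _ at this
        exact (hk (senderParent N v)).2 (by omega)
      have L3 := hC.layer3.correct v
      have hb := hC.isBranch_iff v
      refine ⟨fun hv u hu => ?_, fun hv u => ?_⟩
      · have := (finalArc_iff_not_isRedundant hC (hp hv) u).2 hu
        exact hq.le_arc L3 (hC.arc_le v) hb u this.1 this.2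
      · have hp' := hp (by omega)
        rw [← finalArc_iff_not_isRedundant hC hp' u]
        exact hq.arc L3 (hC.arc_le v) hb (fun w h1 h2 => (hk v).1 (by omega) w
          ((finalArc_iff_not_isRedundant hC hp' w).1 ⟨h2, h1⟩)) u)
    (2 * N.diam + 2)
  rw [show 7 * N.diam + 11 = 5 * N.diam + 9 + (2 * N.diam + 2) by ring]
  refine h1.mono fun C hC => ⟨hC.1, fun v => (hC.2 v).2 ?_⟩
  have := distTo_le_diam (N := N) N.senders_nonempty v
  omega

/-! ### Final configurations -/

theorem NodeState.eq_of_fields {q q' : NodeState N v} (h1 : q.l1Dist = q'.l1Dist)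
    (h2 : q.l1Parent = q'.l1Parent) (h3 : q.l1Color = true ↔ q'.l1Color = true)
    (h4 : q.l2Dist = q'.l2Dist) (h5 : q.l2Parent = q'.l2Parent)
    (h6 : q.l2Color = true ↔ q'.l2Color = true)
    (h7 : ∀ u, q.l3Arc u = true ↔ q'.l3Arc u = true)
    (h8 : ∀ u, q.arc u = true ↔ q'.arc u = true)
    (h9 : q.l4Branch = true ↔ q'.l4Branch = true) : q = q' := by
  cases q; cases q'
  simp only [← Bool.eq_iff_iff, ← funext_iff] at *
  subst h1 h2 h3 h4 h5 h6 h7 h8 h9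
  rfl

/-- Each field of an outcome equals its locally correct value, and in a stable configuration that is
the current value. -/
theorem Stable.eq_of_outcome (h : Stable C) (v : V) (q : NodeState N v)
    (hq : Outcome (mwstdag N) C v q) : q = C v := by
  have hb := h.branchStable
  have h3 := hb.layer3
  have L3 := h3.correct v
  have hr := finalArc_iff_not_isRedundant hb (v := v) fun _ => h.arc _
  refine NodeState.eq_of_fields (hq.l1Dist.trans L3.layer1.dist.symm)
    ((hq.l1Parent L3.layer1.dist).trans L3.layer1.parent.symm)
    ((hq.l1Color L3.layer1.dist L3.layer1.parent).trans L3.layer1.color.symm)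
    ((hq.l2Dist L3.layer1).trans L3.layer2.dist.symm)
    ((hq.l2Parent L3.layer1 L3.layer2.dist).trans L3.layer2.parent.symm)
    ((hq.l2Color L3.layer1 L3.layer2.dist L3.layer2.parent).trans L3.layer2.color.symm)
    (fun u => (hq.l3Arc L3.layer1 L3.layer2 u).trans (L3.arc u).symm)
    (fun u => ?_)
    ((hq.l4Branch L3 (hb.arc_le v)).trans (hb.isBranch_iff v).symm)
  rw [h.arc, ← hr]
  exact hq.arc L3 (hb.arc_le v) (hb.isBranch_iff v)
    (fun w h1 h2 => (h.arc v w).2 ((hr w).1 ⟨h2, h1⟩)) u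

theorem Stable.isFinal (h : Stable C) : IsFinal (mwstdag N) C :=
  fun _ _ => Step.of_outcome h.eq_of_outcome

theorem IsFinal.stable [Finite V] (h : IsFinal (mwstdag N) C) : Stable C :=
  haveI := N.nontrivial
  h.of_attains attains_stable

theorem Stable.spec [Finite V] (h : Stable C) : Spec N C := by
  refine isMinimal_of_arc_eq _ rfl ?_
  funext v u
  refine propext ⟨fun ⟨ha, hu⟩ => (h.arc v ⟨u, ha⟩).1 hu, fun hu => ?_⟩
  have ha := (finalArc_iff.1 hu).1.adj
  exact ⟨ha, (h.arc v ⟨u, ha⟩).2 hu⟩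

theorem Stable.mem_distAtMost [Finite V] (h : Stable C) (v : V) :
    C v ∈ distAtMost N N.diam v := by
  constructor
  · rw [h.branchStable.layer3.layer1.dist]
    exact distTo_le_diam N.senders_nonempty v
  · rw [h.branchStable.layer3.layer2.dist]
    exact distTo_le_diam red_nonempty v

theorem finalWithinRounds [Finite V] : FinalWithinRounds (mwstdag N) (18 * N.diam) := by
  intro S Ξ hS hΞ
  obtain ⟨t, ht, h⟩ := attains_stable S Ξ hS hΞ
  -- Absorbs the additive constant: `7 * D + 11 ≤ 18 * D` for `D ≥ 1`.
  have := N.one_le_diam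
  exact ⟨_, t, by omega, ht, (h t le_rfl).isFinal⟩

theorem isSilent [Finite V] : IsSilent (mwstdag N) := fun S Ξ hS hΞ =>
  let ⟨_, t, _, _, h⟩ := finalWithinRounds S Ξ hS hΞ
  ⟨t, h⟩

theorem isSelfStabilizing [Finite V] : IsSelfStabilizing (mwstdag N) (Spec N) :=
  -- The final configurations serve as legitimate set; being stable, they are unchanged by any step.
  ⟨{C | IsFinal (mwstdag N) C}, isSilent,
    fun _ _ _ hC hs => by rwa [hs.eq_of_outcome (IsFinal.stable hC).eq_of_outcome],
    fun _ hC => (IsFinal.stable hC).spec⟩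

theorem exists_minimal [Finite V] :
    ∃ H : DirSubgraph N.graph, IsMinimalWeaklySTReachableDAG N H :=
  ⟨⟨Set.univ, FinalArc N, fun _ _ _ => trivial, fun _ _ _ => trivial,
    fun _ _ h => (finalArc_iff.1 h).1.adj⟩, isMinimal_of_arc_eq _ rfl rfl⟩

end Convergence

/-! ### Bounded distances and the encoding of states -/

section Memory

variable {V : Type*} {N : Network V} {v : V}

/-- The node states whose distances exceed `M` by at most the distance to the senders and to the
targets, respectively. -/
def distBounded (N : Network V) (M : ℕ) (v : V) : Set (NodeState N v) :=
  {q | q.l1Dist ≤ M + distTo N N.senders v ∧ q.l2Dist ≤ M + distTo N N.targets v}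

theorem iInf_le_of_distTo {X : Set V} (hX : X.Nonempty) (hv : v ∉ X) {M : ℕ} {d : V → ℕ}
    (hd : ∀ u, d u ≤ M + distTo N X u) :
    (⨅ u : Nbr N.graph v, d u.1) + 1 ≤ M + distTo N X v := by
  obtain ⟨u, hu⟩ := exists_distTo_succ (N := N) hX hv
  have h1 : (⨅ u : Nbr N.graph v, d u.1) ≤ d u.1 := ciInf_le' (fun u : Nbr N.graph v => d u.1) u
  have h2 := hd u.1
  omega

theorem Step.mem_distBounded {M : ℕ} {X : Set V} {C C' : Config (NodeState N)}
    (hC : ∀ v, C v ∈ distBounded N M v) (h : Step (mwstdag N) X C C') (v : V) :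
    C' v ∈ distBounded N M v := by
  by_cases hv : v ∈ X
  · have ho := h.outcome hv
    constructor
    · rw [ho.l1Dist, l1CorrectDist]
      split_ifs with hs
      · exact Nat.zero_le _
      · exact iInf_le_of_distTo N.senders_nonempty hs fun u => (hC u).1
    · rcases ho.l2Dist_or with h2 | ⟨L1, h2⟩
      · rw [h2]; exact (hC v).2
      · rw [h2, l2CorrectDist]
        split_ifs with hr
        · exact Nat.zero_le _
        -- Red colours vary during the execution, so the bound refers to the targets: layer 2 acts
        -- only when layer 1 is locally correct, and then a target is red.
        · exact iInf_le_of_distTo N.targets_nonempty (fun ht => hr (L1.color.2 (Or.inl ht)))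
            fun u => (hC u).2
  · rw [h.eq_of_notMem hv]; exact hC v

/-- A node state as a tuple of numbers below `K` and Boolean vectors. -/
noncomputable def NodeState.toTuple {K : ℕ} [NeZero K] (q : NodeState N v) :
    (Fin K × Fin K) × (Fin 4 → Nbr N.graph v → Bool) × (Fin 3 → Bool) := by
  classical
  -- Distances are reduced modulo `K`, which loses nothing below `K`. A parent becomes its indicator
  -- vector on the neighbours, the zero vector meaning `v` itself.
  exact ((Fin.ofNat K q.l1Dist, Fin.ofNat K q.l2Dist),
    ![fun u => decide (q.l1Parent.1 = u.1), fun u => decide (q.l2Parent.1 = u.1), q.l3Arc, q.arc],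
    ![q.l1Color, q.l2Color, q.l4Branch])

theorem CNbr.eq_of_forall_iff {p p' : CNbr N.graph v}
    (h : ∀ u : Nbr N.graph v, p.1 = u.1 ↔ p'.1 = u.1) : p = p' := by
  obtain ⟨p, hp⟩ := p
  obtain ⟨p', hp'⟩ := p'
  rw [Subtype.mk.injEq]
  rcases hp with rfl | hp
  · rcases hp' with rfl | hp'
    · rfl
    · exact (h ⟨p', hp'⟩).2 rfl
  · exact ((h ⟨p, hp⟩).1 rfl).symm

theorem NodeState.toTuple_injOn {K : ℕ} [NeZero K] :
    Set.InjOn (NodeState.toTuple (K := K))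
      {q : NodeState N v | q.l1Dist < K ∧ q.l2Dist < K} := by
  intro q hq q' hq' h
  simp only [toTuple, Prod.mk.injEq] at h
  obtain ⟨⟨h1, h2⟩, h3, h4⟩ := h
  have h1 := congrArg Fin.val h1
  have h2 := congrArg Fin.val h2
  simp only [Fin.val_ofNat, Nat.mod_eq_of_lt hq.1, Nat.mod_eq_of_lt hq.2, Nat.mod_eq_of_lt hq'.1,
    Nat.mod_eq_of_lt hq'.2] at h1 h2
  have a0 := congrFun (congrFun h3 0)
  have a1 := congrFun (congrFun h3 1)
  have a2 := congrFun (congrFun h3 2)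
  have a3 := congrFun (congrFun h3 3)
  have b0 := congrFun h4 0
  have b1 := congrFun h4 1
  have b2 := congrFun h4 2
  simp at a0 a1 a2 a3 b0 b1 b2
  exact NodeState.eq_of_fields h1 (CNbr.eq_of_forall_iff fun u => a0 u.1 u.2) (by rw [b0]) h2
    (CNbr.eq_of_forall_iff fun u => a1 u.1 u.2) (by rw [b1]) (fun u => by rw [a2]) (fun u => by rw [a3])
    (by rw [b2])

open Classical in
theorem card_nbr_le_maxDeg [Fintype V] (v : V) : Fintype.card (Nbr N.graph v) ≤ N.maxDeg := by
  refine (le_of_eq ?_).trans (N.graph.degree_le_maxDegree v)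
  rw [← SimpleGraph.card_neighborSet_eq_degree]
  exact Fintype.card_congr (Equiv.refl _)

theorem Network.one_le_maxDeg [Fintype V] (N : Network V) : 1 ≤ N.maxDeg := by
  classical
  obtain ⟨s, -⟩ := N.senders_nonempty
  have := N.nonempty_nbr s
  exact (Fintype.card_pos (α := Nbr N.graph s)).trans_le (card_nbr_le_maxDeg s)

theorem exists_encoding [Fintype V] (K : ℕ) {b : ℕ} (hb : 2 * K + 4 * N.maxDeg + 3 ≤ b) (v : V) :
    ∃ enc : NodeState N v → (Fin b → Bool),
      Set.InjOn enc {q | q.l1Dist < 2 ^ K ∧ q.l2Dist < 2 ^ K} := by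
  classical
  have hcard : Fintype.card ((Fin (2 ^ K) × Fin (2 ^ K)) ×
      (Fin 4 → Nbr N.graph v → Bool) × (Fin 3 → Bool)) ≤ Fintype.card (Fin b → Bool) := by
    have : Fintype.card ((Fin (2 ^ K) × Fin (2 ^ K)) ×
      (Fin 4 → Nbr N.graph v → Bool) × (Fin 3 → Bool)) =
        2 ^ (2 * K + 4 * Fintype.card (Nbr N.graph v) + 3) := by
      simp only [Fintype.card_prod, Fintype.card_fun, Fintype.card_fin, Fintype.card_bool]
      ring
    rw [this, Fintype.card_fun, Fintype.card_fin, Fintype.card_bool]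
    have := card_nbr_le_maxDeg (N := N) v
    exact Nat.pow_le_pow_right two_pos (by omega)
  obtain ⟨f⟩ := Function.Embedding.nonempty_of_card_le hcard
  exact ⟨f ∘ NodeState.toTuple, f.injective.comp_injOn NodeState.toTuple_injOn⟩

theorem runsInBits [Fintype V] (N : Network V) (M : ℕ) :
    RunsInBits (mwstdag N) (distAtMost N M)
      (18 * (Nat.log 2 (max M N.diam) + N.maxDeg)) := by
  refine ⟨distBounded N M, fun v q hq => ⟨hq.1.trans (Nat.le_add_right _ _),
    hq.2.trans (Nat.le_add_right _ _)⟩, fun X C C' hC hs => hs.mem_distBounded hC, fun v => ?_⟩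
  have hΔ := N.one_le_maxDeg
  -- Distances are at most `M + D ≤ 2 * max M D`, which is below `2 ^ (log + 2)`. The additive
  -- constants in the bit count are absorbed by the maximum degree being at least `1`.
  obtain ⟨enc, h⟩ := exists_encoding (N := N) (Nat.log 2 (max M N.diam) + 2)
    (b := 18 * (Nat.log 2 (max M N.diam) + N.maxDeg)) (by omega) v
  refine ⟨enc, h.mono fun q hq => ?_⟩
  have h1 := Nat.lt_pow_succ_log_self one_lt_two (max M N.diam)
  have h2 := distTo_le_diam (N := N) N.senders_nonempty v
  have h3 := distTo_le_diam (N := N) N.targets_nonempty v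
  have h4 := hq.1
  have h5 := hq.2
  rw [Set.mem_ofPred_eq, pow_succ]
  omega

end Memory

end MWST

theorem mainTheorem1 :
    ∃ c : ℕ, ∀ (V : Type*) [Fintype V] (N : MWST.Network V),
      MWST.IsSelfStabilizing (MWST.mwstdag N) (MWST.Spec N) ∧
      MWST.IsSilent (MWST.mwstdag N) ∧
      MWST.FinalWithinRounds (MWST.mwstdag N) (c * N.diam) ∧
      (∀ M : ℕ, MWST.RunsInBits (MWST.mwstdag N) (MWST.distAtMost N M)
        (c * (Nat.log 2 (max M N.diam) + N.maxDeg))) ∧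
      (∀ C, MWST.IsFinal (MWST.mwstdag N) C →
        MWST.Spec N C ∧ ∀ v, C v ∈ MWST.distAtMost N N.diam v) ∧
      (∃ H : MWST.DirSubgraph N.graph, MWST.IsMinimalWeaklySTReachableDAG N H) :=
  ⟨18, fun _ _ N => ⟨MWST.isSelfStabilizing, MWST.isSilent, MWST.finalWithinRounds,
    MWST.runsInBits N, fun _ hC => ⟨(MWST.IsFinal.stable hC).spec,
      (MWST.IsFinal.stable hC).mem_distAtMost⟩, MWST.exists_minimal⟩⟩
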